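/- **Definitions.** A *(colored) finite subdivision rule* $R$ of dimension $d$ consists of: a finite CW complex $S_R$ of pure dimension $d$ (it is the union of its closed $d$-cells and has no cells of higher dimension) such that for every $d$-cell the closed $d$-disk carries a CW structure, with the open disk as its only open $d$-cell and the remaining cells in the boundary sphere, in which any two distinct closed cells that intersect do so in a single closed cell of lower dimension, and for which the characteristic map of the $d$-cell is a homeomorphism from each open cell onto an open cell of $S_R$; a finite pure $d$-dimensional CW complex $R(S_R)$ subdividing $S_R$; a partition of the $d$-cells (tiles) of $S_R$ into ideal and non-ideal ones; and a continuous cellular map $\phi_R:R(S_R)\to S_R$ that maps each open cell homeomorphically onto an open cell and maps the union of the closed ideal tiles into itself. An *$R$-complex* is a CW complex $X$ of pure dimension $d$ with a continuous cellular map $f:X\to S_R$ that maps each open cell homeomorphically onto an open cell; it is *finite* if it has finitely many cells. Put $R^0(X)=X$, and let $R^{n+1}(X)$ be the subdivision of $R^n(X)$ obtained by pulling back the cells of $R(S_R)$ under $\phi_R^n\circ f$. A tile ($d$-cell) of $R^n(X)$ is ideal or non-ideal according to its image in $S_R$ under $\phi_R^n\circ f$. $\Lambda_n$ is the union of the closed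 non-ideal tiles of $R^n(X)$; the *ideal set* $\Omega$ is the union over all $n$ of the interior of the union of the closed ideal tiles of $R^n(X)$; the *limit set* is $\Lambda=X\setminus\Omega$. The graph $\Gamma_n$ has a vertex for each cell of $R^n(X)$ contained in $\Lambda_n$ and an edge for each proper inclusion of closed cells; $d_n$ is its path metric. The *history graph* $\Gamma=\Gamma(R,X)$ consists of an origin $O$, the disjoint union of the $\Gamma_n$, edges from $O$ to all vertices of $\Gamma_0$, and an edge from each vertex of $\Gamma_n$, corresponding to an open cell $T$, to each vertex of $\Gamma_{n+1}$ whose open cell is contained in $T$. $\Gamma$ carries its path metric $d_\Gamma$. **Theorem.** Let $R$ be a finite subdivision rule and $X$ a finite $R$-complex. Suppose that $\Gamma=\Gamma(R,X)$ is quasi-isometric to a finitely generated group (that is, to a Cayley graph of the group for a finite generating set). Then the following are equivalent: 1. $\Gamma$ is quasi-isometric to $\mathbb Z$. 2. $\Lambda$ has exactly two connected components, and the diameters of the connected components of the $\Lambda_n$, measured in the history graph, are uniformly bounded: there is $D$ such that $d_\Gamma(a,b)\le D$ for every $n$ and all cells $a,b$ of $\Lambda_n$ lying in the same component of $\Lambda_n$.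 3. $\Lambda$ has exactly two connected components, and the $d_n$-diameters of the components of the $\Lambda_n$, as seen from $\Lambda$, are uniformly bounded: there is $D$ such that $d_n(a,b)\le D$ for every $n$ and all cells $a,b$ of $\Lambda_n$ lying in the same component of $\Lambda_n$ whose open cells meet $\Lambda$. -/

import Mathlib

open Set Metric Topology

universe u v w

/-! ### Cell structures -/

/-- The open `k`-cells of a CW complex, as subsets of the ambient space. -/
def openCells {X : Type u} [TopologicalSpace X] {C : Set X} (c : CWComplex C) (k : ℕ) :
    Set (Set X) :=
  {e | ∃ i : c.cell k, e = c.map k i '' ball 0 1}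

/-- A CW structure on the whole space `X` is of pure dimension `d`: there are no cells of dimension
greater than `d`, and the space is the union of its closed `d`-cells. (In a Hausdorff space the
closed cell is the closure of the open cell.) -/
structure IsPureCW {X : Type u} [TopologicalSpace X] (c : CWComplex (univ : Set X)) (d : ℕ) :
    Prop where
  isEmpty_cell : ∀ k, d < k → IsEmpty (c.cell k)
  exists_mem_closure : ∀ x : X, ∃ e ∈ openCells c d, x ∈ closure e

/-- A continuous cellular map which maps every open cell homeomorphically onto an open cell
(necessarily of the same dimension). -/
structure IsCellHomeo {X : Type u} {Y : Type v} [TopologicalSpace X] [TopologicalSpace Y]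
    (c : CWComplex (univ : Set X)) (c' : CWComplex (univ : Set Y)) (f : X → Y) : Prop where
  continuous : Continuous f
  image_mem : ∀ k, ∀ e ∈ openCells c k, f '' e ∈ openCells c' k
  isEmbedding : ∀ k, ∀ e ∈ openCells c k, IsEmbedding (e.domRestrict f)

/-- The `d`-cell `t` is polyhedral: the closed `d`-disk carries a CW structure `s` with one open
`d`-cell, the open disk, whose remaining cells lie in the boundary sphere, such that any two
distinct closed cells that intersect do so in a single closed cell of lower dimension, and the
characteristic map of `t` restricts to a homeomorphism from each open cell of `s` onto an open cell
of `S`. (The disk is the unit ball of `Fin d → ℝ`, as in Mathlib's CW complexes.) -/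
def IsPolyhedralCell {S : Type u} [TopologicalSpace S] (c : CWComplex (univ : Set S)) (d : ℕ)
    (t : c.cell d) : Prop :=
  ∃ s : CWComplex (closedBall (0 : Fin d → ℝ) 1),
    ball 0 1 ∈ openCells s d ∧
    (∀ k, ∀ a ∈ openCells s k, a ≠ ball 0 1 → a ⊆ sphere 0 1) ∧
    (∀ k, ∀ a ∈ openCells s k,
      c.map d t '' a ∈ openCells c k ∧ IsEmbedding (a.domRestrict (c.map d t))) ∧
    (∀ k l, ∀ a ∈ openCells s k, ∀ b ∈ openCells s l, a ≠ b → (closure a ∩ closure b).Nonempty →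
      ∃ m < max k l, ∃ e ∈ openCells s m, closure a ∩ closure b = closure e)

/-! ### Subdivision rules and their complexes -/

/-- A (colored) finite subdivision rule of dimension `d`. -/
structure SubdivisionRule (d : ℕ) where
  /-- The underlying space of the subdivision complex. -/
  S : Type u
  [top : TopologicalSpace S]
  [t2 : T2Space S]
  /-- The cell structure of the subdivision complex `S_R`. -/
  cw : CWComplex (univ : Set S)
  finite_cw : Finite (Σ k, cw.cell k)
  pure_cw : IsPureCW cw d
  polyhedral : ∀ t : cw.cell d, IsPolyhedralCell cw d t
  /-- The cell structure of the subdivision `R(S_R)` of `S_R`. -/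
  sub : CWComplex (univ : Set S)
  finite_sub : Finite (Σ k, sub.cell k)
  pure_sub : IsPureCW sub d
  /-- Every open cell of `R(S_R)` is contained in an open cell of `S_R`. -/
  sub_refines : ∀ k, ∀ e ∈ openCells sub k, ∃ l, ∃ e' ∈ openCells cw l, e ⊆ e'
  /-- The ideal tiles; the other open `d`-cells of `S_R` are the non-ideal tiles. -/
  ideal : Set (Set S)
  ideal_subset : ideal ⊆ openCells cw d
  /-- The subdivision map `R(S_R) → S_R`. -/
  φ : S → S
  φ_cellHomeo : IsCellHomeo sub cw φ
  φ_ideal : MapsTo φ (⋃ e ∈ ideal, closure e) (⋃ e ∈ ideal, closure e)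

attribute [instance] SubdivisionRule.top SubdivisionRule.t2

/-- An `R`-complex. -/
structure RComplex {d : ℕ} (R : SubdivisionRule.{u} d) where
  /-- The underlying space. -/
  X : Type v
  [top : TopologicalSpace X]
  [t2 : T2Space X]
  cw : CWComplex (univ : Set X)
  pure_cw : IsPureCW cw d
  /-- The structure map to the subdivision complex. -/
  f : X → R.S
  f_cellHomeo : IsCellHomeo cw R.cw f

attribute [instance] RComplex.top RComplex.t2

namespace RComplex

variable {d : ℕ} {R : SubdivisionRule.{u} d} (K : RComplex.{u, v} R)

/-- A finite `R`-complex: one with finitely many cells. -/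
def IsFinite : Prop := Finite (Σ k, K.cw.cell k)

/-- The structure map `φ_R ^ n ∘ f` of the subdivided complex `R^n(X)`. -/
def levelMap (n : ℕ) : K.X → R.S := R.φ^[n] ∘ K.f

/-- The open cells of `R^n(X)`: those of `R^(n+1)(X)` are obtained by pulling back the open cells
of `R(S_R)` to the open cells of `R^n(X)`, each of which is mapped homeomorphically onto an open
cell of `S_R` by the structure map of `R^n(X)`. -/
def cells : ℕ → Set (Set K.X)
  | 0 => {e | ∃ k, e ∈ openCells K.cw k}
  | n + 1 => {e | ∃ e₀ ∈ cells n, ∃ k, ∃ c ∈ openCells R.sub k,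
      c ⊆ K.levelMap n '' e₀ ∧ e = e₀ ∩ K.levelMap n ⁻¹' c}

/-- The ideal (open) tiles of `R^n(X)`: those whose type is an ideal tile of `S_R`. -/
def idealTiles (n : ℕ) : Set (Set K.X) :=
  {e | e ∈ K.cells n ∧ K.levelMap n '' e ∈ R.ideal}

/-- The non-ideal (open) tiles of `R^n(X)`. -/
def nonIdealTiles (n : ℕ) : Set (Set K.X) :=
  {e | e ∈ K.cells n ∧ K.levelMap n '' e ∈ openCells R.cw d ∧ K.levelMap n '' e ∉ R.ideal}

/-- `Λ_n`, the union of the non-ideal closed tiles of `R^n(X)`. -/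
def limitLevel (n : ℕ) : Set K.X := ⋃ e ∈ K.nonIdealTiles n, closure e

/-- The ideal set `Ω`: the union over all levels `n` of the interior of the union of the ideal
closed tiles of `R^n(X)`. -/
def idealSet : Set K.X := ⋃ n, interior (⋃ e ∈ K.idealTiles n, closure e)

/-- The limit set `Λ`, the complement of the ideal set. -/
def limitSet : Set K.X := (K.idealSet)ᶜ

/-! ### The history graph -/

/-- The vertices of `Γ_n`: the (open) cells of `R^n(X)` that are contained in `Λ_n`. -/
def LevelVertex (n : ℕ) : Type v := {e : Set K.X // e ∈ K.cells n ∧ e ⊆ K.limitLevel n}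

/-- The graph `Γ_n`: two distinct cells of `Λ_n` are joined if the closure of one contains the
closure of the other. -/
def levelGraph (n : ℕ) : SimpleGraph (K.LevelVertex n) :=
  SimpleGraph.fromRel fun a b => closure a.1 ⊆ closure b.1

/-- The vertices of the history graph: the origin `none` and the vertices of all `Γ_n`. -/
abbrev HistoryVertex : Type v := Option (Σ n, K.LevelVertex n)

/-- The edges of the history graph (each in one orientation). -/
inductive HistoryEdge : K.HistoryVertex → K.HistoryVertex → Prop
  /-- The origin is joined to every vertex of `Γ_0`. -/
  | origin (a : K.LevelVertex 0) : HistoryEdge none (some ⟨0, a⟩)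
  /-- The edges of the `Γ_n`. -/
  | horizontal (n : ℕ) (a b : K.LevelVertex n) (h : (K.levelGraph n).Adj a b) :
      HistoryEdge (some ⟨n, a⟩) (some ⟨n, b⟩)
  /-- A cell of `Λ_n` is joined to the cells of `Λ_(n+1)` that it contains as open cells. -/
  | vertical (n : ℕ) (a : K.LevelVertex n) (b : K.LevelVertex (n + 1)) (h : b.1 ⊆ a.1) :
      HistoryEdge (some ⟨n, a⟩) (some ⟨n + 1, b⟩)

/-- The history graph `Γ(R,X)`. -/
def historyGraph : SimpleGraph K.HistoryVertex := SimpleGraph.fromRel K.HistoryEdge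

/-- `a` and `b` are cells of a common connected component of the space `Λ_n`. -/
def SameComponent (n : ℕ) (a b : K.LevelVertex n) : Prop :=
  ∃ x ∈ K.limitLevel n, a.1 ⊆ connectedComponentIn (K.limitLevel n) x ∧
    b.1 ⊆ connectedComponentIn (K.limitLevel n) x

end RComplex

/-! ### Quasi-isometry -/

/-- The spaces `(A, dA)` and `(B, dB)` are quasi-isometric. -/
def QuasiIsometric {A : Type u} {B : Type v} (dA : A → A → ℝ) (dB : B → B → ℝ) : Prop :=
  ∃ (f : A → B) (K : ℝ), 0 < K ∧
    (∀ x y, 1 / K * dA x y - K ≤ dB (f x) (f y) ∧ dB (f x) (f y) ≤ K * dA x y + K) ∧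
    ∀ z, ∃ x, dB z (f x) < K

/-- The path metric on the vertex set of a connected graph (which is quasi-isometric to the
geometric realization of the graph with edges of length one). -/
noncomputable def graphDist {V : Type u} (G : SimpleGraph V) (x y : V) : ℝ := G.dist x y

/-! Every cell of `Γ_m` has an ancestor in each `Γ_n` with `n ≤ m`, and ancestors of adjacent
vertices are equal or adjacent. So a path of the history graph that only visits vertices of `Γ_m`
with `m ≥ n` projects to a path of `Γ_n` that is no longer (`edist_le_of_walk`). Moreover `Λ` is the
intersection of the decreasing compact sets `Λ_n` (`limitSet_eq_iInter`), and two points of `Λ`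
share a component exactly when their cells are connected in every `Γ_n`
(`connectedComponents_eq_iff`).

Suppose `Γ` is quasi-isometric to the line. The quasi-isometry gives a height function vanishing at
`O` (`IsCoarseHeight`). It keeps its sign along paths outside a ball of radius `B` about `O`, and
vertices of equal level and equal sign are within `2 * B` of each other. Each sign yields a limit
point by compactness. Geodesics between deep cells project to every `Γ_n`, so points of `Λ` of equal
sign lie in one component and their cells are uniformly close in all `Γ_n` (`edist_le_of_pos`). This
gives the component count and the second diameter bound; the first bound comes from the closeness of
vertices of equal level and sign.

Conversely, choose a point in each of the two components. The vertical rays of cells around these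
points form a line in `Γ`. Some `Γ_n₀` separates the two points, so a path from one ray to the other
must come back to level `n₀` or less, which makes the line coarsely isometric to `ℤ`. It is coarsely
dense because cells are near cells meeting `Λ` (`exists_near_limitSet`), and those are near a ray by
the diameter bound (`quasiIsometric_int`). Only cells meeting `Λ` matter here, so both diameter
conditions suffice.

Underneath lies the fact that closed cells of `R^n(X)` are unions of open cells
(`subset_closure_of_mem`), which is deduced from the polyhedral structure of tiles by lifting
characteristic maps (`exists_lift_closedBall`). -/

/-! ### Cells of CW complexes -/

section Cells

variable {X : Type u} [TopologicalSpace X] {C : Set X} {c : CWComplex C} {k l : ℕ} {e e' : Set X}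

theorem openCells_unique (he : e ∈ openCells c k) (he' : e' ∈ openCells c l) {x : X}
    (hx : x ∈ e) (hx' : x ∈ e') : k = l ∧ e = e' := by
  let := c
  obtain ⟨i, rfl⟩ := he
  obtain ⟨j, rfl⟩ := he'
  by_cases h : (⟨k, i⟩ : Σ n, c.cell n) = ⟨l, j⟩
  · cases h
    exact ⟨rfl, rfl⟩
  · exact ((disjoint_left.1 (c.pairwiseDisjoint' (mem_univ ⟨k, i⟩) (mem_univ ⟨l, j⟩) h)) hx hx').elim

theorem openCells_nonempty (he : e ∈ openCells c k) : e.Nonempty := by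
  obtain ⟨i, rfl⟩ := he
  exact ⟨_, mem_image_of_mem _ (mem_ball_self one_pos)⟩

theorem openCells_isPreconnected (he : e ∈ openCells c k) : IsPreconnected e := by
  obtain ⟨i, rfl⟩ := he
  exact (convex_ball _ _).isPreconnected.image _
    ((c.continuousOn k i).mono ball_subset_closedBall)

theorem openCells_subset (he : e ∈ openCells c k) : e ⊆ C := by
  let := c
  obtain ⟨i, rfl⟩ := he
  exact CWComplex.openCell_subset_complex (C := C) k i

theorem exists_mem_openCells {x : X} (hx : x ∈ C) : ∃ k, ∃ e ∈ openCells c k, x ∈ e := by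
  let := c
  rw [← CWComplex.iUnion_openCell_eq_complex (C := C)] at hx
  simp only [mem_iUnion] at hx
  obtain ⟨k, i, hx⟩ := hx
  exact ⟨k, _, ⟨i, rfl⟩, hx⟩

theorem closure_openCells_eq [T2Space X] (i : c.cell k) :
    closure (c.map k i '' ball 0 1) = c.map k i '' closedBall 0 1 := by
  let := c
  exact CWComplex.closure_openCell_eq_closedCell (C := C) (n := k) (j := i)

theorem openCells_isCompact_closure [T2Space X] (he : e ∈ openCells c k) :
    IsCompact (closure e) := by
  obtain ⟨i, rfl⟩ := he
  rw [closure_openCells_eq]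
  exact (isCompact_closedBall _ _).image_of_continuousOn (c.continuousOn k i)

theorem openCells_closure_cases [T2Space X] (he : e ∈ openCells c k) {x : X}
    (hx : x ∈ closure e) : x ∈ e ∨ ∃ l < k, ∃ e' ∈ openCells c l, x ∈ e' := by
  let := c
  obtain ⟨i, rfl⟩ := he
  rw [closure_openCells_eq] at hx
  obtain ⟨z, hz, rfl⟩ := hx
  rw [← sphere_union_ball] at hz
  rcases hz with hz | hz
  · right
    obtain ⟨I, hI⟩ := CWComplex.cellFrontier_subset_finite_openCell (C := C) k i
    have := hI (mem_image_of_mem _ hz)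
    simp only [mem_iUnion] at this
    obtain ⟨m, hm, j, _, hj⟩ := this
    exact ⟨m, hm, _, ⟨j, rfl⟩, hj⟩
  · exact Or.inl (mem_image_of_mem _ hz)

/-- A point of an open `l`-cell in the closure of another open `k`-cell forces `l < k`. -/
theorem openCells_lt_of_mem_closure [T2Space X] (he : e ∈ openCells c k)
    (he' : e' ∈ openCells c l) (hne : e ≠ e') {x : X} (hx : x ∈ closure e) (hx' : x ∈ e') :
    l < k := by
  rcases openCells_closure_cases he hx with h | ⟨m, hm, e'', he'', h⟩
  · exact (hne (openCells_unique he he' h hx').2).elim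
  · exact (openCells_unique he'' he' h hx').1 ▸ hm

theorem finite_openCells (hc : Finite (Σ k, c.cell k)) : {e | ∃ k, e ∈ openCells c k}.Finite := by
  refine (finite_range fun i : Σ k, c.cell k => c.map i.1 i.2 '' ball 0 1).subset ?_
  rintro e ⟨k, i, rfl⟩
  exact ⟨⟨k, i⟩, rfl⟩

/-- In a CW structure on a disk or on any other space in which distinct closed cells meet in single
closed cells of lower dimension, closed cells are unions of open cells. -/
theorem subset_closure_of_inter_eq_closure [T2Space X]
    (h : ∀ k l, ∀ a ∈ openCells c k, ∀ b ∈ openCells c l, a ≠ b →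
      (closure a ∩ closure b).Nonempty →
      ∃ m < max k l, ∃ e ∈ openCells c m, closure a ∩ closure b = closure e)
    (he : e ∈ openCells c k) (he' : e' ∈ openCells c l) {x : X} (hx : x ∈ closure e)
    (hx' : x ∈ e') : e' ⊆ closure e := by
  by_cases hne : e = e'
  · exact hne ▸ subset_closure
  obtain ⟨m, -, a, ha, hae⟩ := h k l e he e' he' hne ⟨x, hx, subset_closure hx'⟩
  have hxa : x ∈ closure a := hae ▸ ⟨hx, subset_closure hx'⟩
  -- If `a ≠ e'`, then `x` forces `e'` to have lower dimension than `a`, while `a ⊆ closure e'`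
  -- forces the opposite.
  by_cases h1 : a = e'
  · have : e' ⊆ closure a := h1 ▸ subset_closure
    rw [← hae] at this
    exact this.trans inter_subset_left
  · have hlm := openCells_lt_of_mem_closure ha he' h1 hxa hx'
    obtain ⟨y, hy⟩ := openCells_nonempty ha
    have hye : y ∈ closure e' := by
      have : y ∈ closure a := subset_closure hy
      rw [← hae] at this
      exact this.2
    exact (lt_asymm hlm (openCells_lt_of_mem_closure he' ha (Ne.symm h1) hye hy)).elim

end Cells

/-! ### Finite complexes of pure dimension: compactness, and open dense tiles. -/

section PureCells

variable {X : Type u} [TopologicalSpace X] {c : CWComplex (univ : Set X)} {d k : ℕ} {e : Set X}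

theorem compactSpace_of_finite_cells [T2Space X] (hc : Finite (Σ k, c.cell k)) : CompactSpace X := by
  refine ⟨?_⟩
  have : (univ : Set X) = ⋃ e ∈ {e | ∃ k, e ∈ openCells c k}, closure e := by
    refine (eq_univ_of_forall fun x => ?_).symm
    obtain ⟨k, e, he, hx⟩ := exists_mem_openCells (c := c) (mem_univ x)
    exact mem_biUnion (show e ∈ {e | ∃ k, e ∈ openCells c k} from ⟨k, he⟩) (subset_closure hx)
  rw [this]
  exact (finite_openCells hc).isCompact_biUnion fun e ⟨k, he⟩ => openCells_isCompact_closure he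

theorem IsPureCW.dim_le (h : IsPureCW c d) (he : e ∈ openCells c k) : k ≤ d := by
  by_contra hk
  obtain ⟨i, -⟩ := he
  exact (h.isEmpty_cell k (not_le.1 hk)).false i

/-- A closed cell meets other open cells only in lower dimension, so the complement of a
top-dimensional cell is the finite union of the remaining closed cells. -/
theorem IsPureCW.isOpen [T2Space X] (h : IsPureCW c d) (hc : Finite (Σ k, c.cell k))
    (he : e ∈ openCells c d) : IsOpen e := by
  have : eᶜ = ⋃ a ∈ {a | (∃ k, a ∈ openCells c k) ∧ a ≠ e}, closure a := by
    ext x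
    simp only [mem_iUnion, mem_ofPred_eq, exists_prop, mem_compl_iff]
    constructor
    · intro hx
      obtain ⟨k, a, ha, hxa⟩ := exists_mem_openCells (c := c) (mem_univ x)
      exact ⟨a, ⟨⟨k, ha⟩, fun hae => hx (hae ▸ hxa)⟩, subset_closure hxa⟩
    · rintro ⟨a, ⟨⟨k, ha⟩, hne⟩, hxa⟩ hx
      exact (openCells_lt_of_mem_closure ha he hne hxa hx).not_ge (h.dim_le ha)
  rw [← isClosed_compl_iff, this]
  exact ((finite_openCells hc).subset fun a ha => ha.1).isClosed_biUnion fun _ _ => isClosed_closure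

theorem IsPureCW.dense (h : IsPureCW c d) : Dense (⋃ e ∈ openCells c d, e) := by
  intro x
  obtain ⟨e, he, hx⟩ := h.exists_mem_closure x
  exact closure_mono (subset_biUnion_of_mem (u := fun e => e) he) hx

end PureCells

/-! ### Lifting characteristic maps -/

open Filter in
/-- Let `F` be a continuous map with finite fibers from a compact Hausdorff space which embeds `e`
onto the image of the open ball under a map `Ψ` that is continuous on the closed ball. Then `Ψ`
lifts to a map that is continuous on the closed ball. -/
theorem exists_lift_closedBall {X : Type u} {S : Type v} [TopologicalSpace X] [CompactSpace X]
    [T2Space X] [TopologicalSpace S] [T2Space S] {F : X → S} (hF : Continuous F)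
    (hfib : ∀ y, (F ⁻¹' {y}).Finite) {e : Set X} (he : IsEmbedding (e.domRestrict F))
    {k : ℕ} {Ψ : (Fin k → ℝ) → S} (hΨ : ContinuousOn Ψ (closedBall 0 1))
    (hΨe : Ψ '' ball 0 1 = F '' e) :
    ∃ g : (Fin k → ℝ) → X, ContinuousOn g (closedBall 0 1) ∧ g '' ball 0 1 = e ∧
      ∀ z ∈ closedBall 0 1, F (g z) = Ψ z := by
  have hcl : closedBall (0 : Fin k → ℝ) 1 = closure (ball 0 1) :=
    (closure_ball _ one_ne_zero).symm
  have hmem : ∀ z ∈ ball (0 : Fin k → ℝ) 1, ∃ x ∈ e, F x = Ψ z := fun z hz =>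
    (hΨe.subset (mem_image_of_mem Ψ hz) : _)
  obtain ⟨x₀, -, -⟩ := hmem 0 (mem_ball_self one_pos)
  have : ∀ z, ∃ x, z ∈ ball (0 : Fin k → ℝ) 1 → x ∈ e ∧ F x = Ψ z := fun z => by
    by_cases hz : z ∈ ball (0 : Fin k → ℝ) 1
    · obtain ⟨x, hx⟩ := hmem z hz
      exact ⟨x, fun _ => hx⟩
    · exact ⟨x₀, fun h => (hz h).elim⟩
  choose g hg using this
  have hgc : ContinuousOn g (ball 0 1) := by
    rw [continuousOn_iff_continuous_domRestrict]
    have h1 : Continuous fun z : ball (0 : Fin k → ℝ) 1 => (⟨g z, (hg z z.2).1⟩ : e) := by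
      rw [he.continuous_iff]
      have : (e.domRestrict F ∘ fun z : ball (0 : Fin k → ℝ) 1 => (⟨g z, (hg z z.2).1⟩ : e))
          = (ball 0 1).domRestrict Ψ := by
        funext z
        exact (hg z z.2).2
      rw [this]
      exact (hΨ.mono ball_subset_closedBall).domRestrict
    exact continuous_subtype_val.comp h1
  have hinj : InjOn F e := fun x hx y hy hxy =>
    congrArg Subtype.val (he.injective (a₁ := ⟨x, hx⟩) (a₂ := ⟨y, hy⟩) hxy)
  -- Cluster points of `g` at `p` lie in the finite fiber over `Ψ p`. Near `p` the ball is convex,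
  -- so the image of `g` is connected and can accumulate at only one point of that fiber.
  have hlim : ∀ p ∈ closedBall (0 : Fin k → ℝ) 1, ∃ x, Tendsto g (𝓝[ball 0 1] p) (𝓝 x) := by
    intro p hp
    have : (𝓝[ball 0 1] p).NeBot := mem_closure_iff_nhdsWithin_neBot.1 (hcl ▸ hp)
    have hFg : Tendsto (F ∘ g) (𝓝[ball 0 1] p) (𝓝 (Ψ p)) := by
      refine (((hΨ p hp).mono ball_subset_closedBall).tendsto).congr' ?_
      filter_upwards [self_mem_nhdsWithin] with z hz
      exact (hg z hz).2.symm
    have hclus : ∀ x, ∀ l ≤ map g (𝓝[ball 0 1] p), ClusterPt x l → F x = Ψ p := by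
      intro x l hl hx
      have h1 : ClusterPt (F x) (map F (map g (𝓝[ball 0 1] p))) :=
        (hx.mono hl).map hF.continuousAt tendsto_map
      have h2 : ClusterPt (F x) (𝓝 (Ψ p)) := h1.mono hFg
      by_contra hne
      exact (clusterPt_iff_not_disjoint.1 h2) (disjoint_nhds_nhds.2 hne)
    obtain ⟨x₁, -, hx₁⟩ := isCompact_univ (X := X) (f := map g (𝓝[ball 0 1] p)) (by simp)
    refine ⟨x₁, ?_⟩
    obtain ⟨U₀, W, hU₀, hW, hxU₀, hW', hdisj⟩ : SeparatedNhds {x₁} (F ⁻¹' {Ψ p} \ {x₁}) :=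
      SeparatedNhds.of_isCompact_isCompact isCompact_singleton
        ((hfib (Ψ p)).subset sdiff_subset).isCompact (disjoint_singleton_left.2 fun h => h.2 rfl)
    rw [singleton_subset_iff] at hxU₀
    rw [tendsto_iff_forall_eventually_mem]
    intro U' hU'
    obtain ⟨U, hUU', hU, hxU⟩ := mem_nhds_iff.1 (inter_mem hU' (hU₀.mem_nhds hxU₀))
    have hUW : Disjoint U W := hdisj.mono_left (hUU'.trans inter_subset_right)
    -- Otherwise compactness gives a cluster point outside `U ∪ W`, although this set contains the
    -- whole fiber over `Ψ p`.
    have hev : ∀ᶠ z in 𝓝[ball 0 1] p, g z ∈ U ∪ W := by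
      by_contra hcon
      have hne : (map g (𝓝[ball 0 1] p) ⊓ 𝓟 (U ∪ W)ᶜ).NeBot := by
        rw [← frequently_mem_iff_neBot]
        simpa using hcon
      obtain ⟨x, hx, hx'⟩ := (hU.union hW).isClosed_compl.isCompact inf_le_right
        (f := map g (𝓝[ball 0 1] p) ⊓ 𝓟 (U ∪ W)ᶜ)
      have hxF := hclus x _ inf_le_left hx'
      refine hx ?_
      by_cases hxx : x = x₁
      · exact Or.inl (hxx ▸ hxU)
      · exact Or.inr (hW' ⟨hxF, hxx⟩)
    obtain ⟨ε, hε, hεs⟩ := Metric.mem_nhdsWithin_iff.1 hev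
    have hpre : IsPreconnected (g '' (ball p ε ∩ ball 0 1)) :=
      ((convex_ball _ _).inter (convex_ball _ _)).isPreconnected.image _
        (hgc.mono inter_subset_right)
    have hsub : g '' (ball p ε ∩ ball 0 1) ⊆ U ∪ W := by
      rintro _ ⟨z, hz, rfl⟩
      exact hεs hz
    have hbm : ball p ε ∩ ball 0 1 ∈ 𝓝[ball 0 1] p :=
      Metric.mem_nhdsWithin_iff.2 ⟨ε, hε, subset_rfl⟩
    have hmeet : (g '' (ball p ε ∩ ball 0 1) ∩ U).Nonempty := by
      have := clusterPt_iff_nonempty.1 hx₁ (hU.mem_nhds hxU) (image_mem_map hbm)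
      rwa [inter_comm] at this
    have := hpre.subset_left_of_subset_union hU hW hUW hsub hmeet
    filter_upwards [hbm] with z hz
    exact (hUU' (this (mem_image_of_mem g hz))).1
  have hext := continuousOn_extendFrom hcl.subset hlim
  have hag : ∀ z ∈ ball (0 : Fin k → ℝ) 1, extendFrom (ball 0 1) g z = g z :=
    extendFrom_extends hgc
  refine ⟨extendFrom (ball 0 1) g, hext, ?_, ?_⟩
  · rw [image_congr hag]
    refine Subset.antisymm (image_subset_iff.2 fun z hz => (hg z hz).1) fun x hx => ?_
    obtain ⟨z, hz, hzx⟩ : F x ∈ Ψ '' ball 0 1 := hΨe ▸ mem_image_of_mem F hx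
    exact ⟨z, hz, hinj (hg z hz).1 hx ((hg z hz).2.trans hzx)⟩
  · intro p hp
    have : (𝓝[ball 0 1] p).NeBot := mem_closure_iff_nhdsWithin_neBot.1 (hcl ▸ hp)
    refine tendsto_nhds_unique (l := 𝓝[ball 0 1] p) (f := F ∘ extendFrom (ball 0 1) g) ?_ ?_
    · exact (hF.tendsto _).comp ((hext p hp).mono ball_subset_closedBall)
    · refine (((hΨ p hp).mono ball_subset_closedBall).tendsto).congr' ?_
      filter_upwards [self_mem_nhdsWithin] with z hz
      rw [Function.comp_apply, hag z hz, (hg z hz).2]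

/-! ### Regions of a subdivision rule -/

namespace SubdivisionRule

variable {d : ℕ} (R : SubdivisionRule.{u} d)

/-- The union of the open tiles. -/
def tileRegion : Set R.S := ⋃ e ∈ openCells R.cw d, e

/-- The union of the open ideal tiles. -/
def idealRegion : Set R.S := ⋃ e ∈ R.ideal, e

/-- The union of the open non-ideal tiles. -/
def nonIdealRegion : Set R.S := ⋃ e ∈ openCells R.cw d \ R.ideal, e

variable {R} {x : R.S}

theorem mem_tileRegion : x ∈ R.tileRegion ↔ ∃ e ∈ openCells R.cw d, x ∈ e := by
  simp [tileRegion]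

theorem mem_idealRegion : x ∈ R.idealRegion ↔ ∃ e ∈ R.ideal, x ∈ e := by
  simp [idealRegion]

theorem mem_nonIdealRegion :
    x ∈ R.nonIdealRegion ↔ ∃ e, (e ∈ openCells R.cw d ∧ e ∉ R.ideal) ∧ x ∈ e := by
  simp [nonIdealRegion]

variable (R)

theorem tileRegion_eq : R.tileRegion = R.idealRegion ∪ R.nonIdealRegion := by
  rw [tileRegion, idealRegion, nonIdealRegion, ← biUnion_union, union_sdiff_cancel R.ideal_subset]

theorem isOpen_nonIdealRegion : IsOpen R.nonIdealRegion :=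
  isOpen_biUnion fun _ he => R.pure_cw.isOpen R.finite_cw he.1

theorem disjoint_idealRegion_nonIdealRegion : Disjoint R.idealRegion R.nonIdealRegion := by
  rw [disjoint_left]
  intro x hx hx'
  obtain ⟨e, he, hxe⟩ := mem_idealRegion.1 hx
  obtain ⟨e', he', hxe'⟩ := mem_nonIdealRegion.1 hx'
  exact he'.2 ((openCells_unique (R.ideal_subset he) he'.1 hxe hxe').2 ▸ he)

variable {R}

/-- Tiles of the subdivision lie in tiles. -/
theorem subset_tile_of_sub {c : Set R.S} (hc : c ∈ openCells R.sub d) :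
    ∃ e ∈ openCells R.cw d, c ⊆ e := by
  obtain ⟨l, e, he, hce⟩ := R.sub_refines d c hc
  obtain ⟨y, hy⟩ := openCells_nonempty hc
  obtain ⟨t, ht, hyt⟩ := R.pure_cw.exists_mem_closure y
  -- Since `c` is open, it meets an open tile; the cell of `S_R` containing `c` must then be that
  -- tile.
  obtain ⟨z, hzc, hzt⟩ := mem_closure_iff.1 hyt c (R.pure_sub.isOpen R.finite_sub hc) hy
  exact ⟨t, ht, (openCells_unique he ht (hce hzc) hzt).2 ▸ hce⟩

theorem exists_sub_of_tileRegion (hx : R.φ x ∈ R.tileRegion) :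
    ∃ c ∈ openCells R.sub d, x ∈ c := by
  obtain ⟨e, he, hxe⟩ := mem_tileRegion.1 hx
  obtain ⟨k, c, hc, hxc⟩ := exists_mem_openCells (c := R.sub) (mem_univ x)
  have := (openCells_unique (R.φ_cellHomeo.image_mem k c hc) he (mem_image_of_mem _ hxc) hxe).1
  exact ⟨c, this ▸ hc, hxc⟩

theorem mem_tileRegion_of_map (hx : R.φ x ∈ R.tileRegion) : x ∈ R.tileRegion := by
  obtain ⟨c, hc, hxc⟩ := exists_sub_of_tileRegion hx
  obtain ⟨e, he, hce⟩ := subset_tile_of_sub hc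
  exact mem_tileRegion.2 ⟨e, he, hce hxc⟩

/-- Non-ideal tiles of the subdivision lie in non-ideal tiles. -/
theorem mem_nonIdealRegion_of_map (hx : R.φ x ∈ R.nonIdealRegion) : x ∈ R.nonIdealRegion := by
  have h := mem_tileRegion_of_map (x := x) (R.tileRegion_eq ▸ Or.inr hx)
  rw [tileRegion_eq] at h
  refine h.resolve_left fun hi => ?_
  obtain ⟨e, he, hxe⟩ := mem_idealRegion.1 hi
  -- If `x` were in an ideal tile, `φ x` would lie in a closed ideal tile, and the open non-ideal
  -- region would meet an open ideal tile.
  have := R.φ_ideal (mem_biUnion he (subset_closure hxe))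
  simp only [mem_iUnion] at this
  obtain ⟨e', he', hφ⟩ := this
  obtain ⟨y, hy, hy'⟩ := mem_closure_iff.1 hφ _ R.isOpen_nonIdealRegion hx
  exact disjoint_left.1 R.disjoint_idealRegion_nonIdealRegion (mem_idealRegion.2 ⟨e', he', hy'⟩) hy

theorem mem_nonIdealRegion_of_iterate {j k : ℕ} (hjk : j ≤ k) :
    R.φ^[k] x ∈ R.nonIdealRegion → R.φ^[j] x ∈ R.nonIdealRegion := by
  induction k, hjk using Nat.le_induction with
  | base => exact id
  | succ k _ ih =>
    rw [Function.iterate_succ_apply']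
    exact fun h => ih (mem_nonIdealRegion_of_map h)

variable (R)

/-- There is a depth such that a tile with non-ideal subtiles at that depth has non-ideal subtiles
at all depths. -/
theorem exists_depth : ∃ N, ∀ t ∈ openCells R.cw d, (∃ y ∈ t, R.φ^[N] y ∈ R.nonIdealRegion) →
    ∀ k, ∃ y ∈ t, R.φ^[k] y ∈ R.nonIdealRegion := by
  have h : ∀ t : Set R.S, ∃ N, (∃ y ∈ t, R.φ^[N] y ∈ R.nonIdealRegion) →
      ∀ k, ∃ y ∈ t, R.φ^[k] y ∈ R.nonIdealRegion := by
    intro t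
    by_contra! hcon
    -- If no depth worked for `t`, some depth `k` would have no non-ideal subtile, yet failure at
    -- `k` itself presupposes one there.
    obtain ⟨-, k, hk⟩ := hcon 0
    obtain ⟨⟨y, hy, hyk⟩, -⟩ := hcon k
    exact hk y hy hyk
  choose N hN using h
  have hfin : (openCells R.cw d).Finite := (finite_openCells R.finite_cw).subset fun e he => ⟨d, he⟩
  obtain ⟨M, hM⟩ := (hfin.image N).bddAbove
  refine ⟨M, fun t ht ⟨y, hy, hyM⟩ => hN t ⟨y, hy, ?_⟩⟩
  exact mem_nonIdealRegion_of_iterate (hM (mem_image_of_mem N ht)) hyM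

end SubdivisionRule

/-! ### The subdivided complexes -/

namespace RComplex

open SubdivisionRule

variable {d : ℕ} {R : SubdivisionRule.{u} d} (K : RComplex.{u, v} R) {n m : ℕ}

theorem levelMap_succ (n : ℕ) (x : K.X) : K.levelMap (n + 1) x = R.φ (K.levelMap n x) :=
  Function.iterate_succ_apply' _ _ _

theorem levelMap_add (n k : ℕ) (x : K.X) : K.levelMap (n + k) x = R.φ^[k] (K.levelMap n x) := by
  rw [add_comm]
  exact Function.iterate_add_apply _ _ _ _

theorem continuous_levelMap (n : ℕ) : Continuous (K.levelMap n) :=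
  (R.φ_cellHomeo.continuous.iterate n).comp K.f_cellHomeo.continuous

variable {K} {e e' : Set K.X}

theorem levelMap_image_inter_preimage {c : Set R.S} (hc : c ⊆ K.levelMap n '' e) :
    K.levelMap n '' (e ∩ K.levelMap n ⁻¹' c) = c := by
  rw [image_inter_preimage, inter_eq_right.2 hc]

theorem image_succ (n : ℕ) {c : Set R.S} (hc : c ⊆ K.levelMap n '' e) :
    K.levelMap (n + 1) '' (e ∩ K.levelMap n ⁻¹' c) = R.φ '' c := by
  have : K.levelMap (n + 1) = R.φ ∘ K.levelMap n := funext (K.levelMap_succ n)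
  rw [this, image_comp, levelMap_image_inter_preimage hc]

theorem exists_image_mem_openCells (he : e ∈ K.cells n) :
    ∃ k, K.levelMap n '' e ∈ openCells R.cw k := by
  cases n with
  | zero => exact he.imp fun k hk => K.f_cellHomeo.image_mem k e hk
  | succ n =>
    obtain ⟨e₀, he₀, k, c, hc, hce, rfl⟩ := he
    exact ⟨k, image_succ n hce ▸ R.φ_cellHomeo.image_mem k c hc⟩

theorem isEmbedding_levelMap : ∀ {n : ℕ} {e : Set K.X}, e ∈ K.cells n →
    IsEmbedding (e.domRestrict (K.levelMap n))
  | 0, _, ⟨k, hk⟩ => K.f_cellHomeo.isEmbedding k _ hk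
  | n + 1, _, ⟨e₀, he₀, k, c, hc, hce, rfl⟩ => by
    have h0 := isEmbedding_levelMap he₀
    have h1 : IsEmbedding fun x : ↥(e₀ ∩ K.levelMap n ⁻¹' c) => (⟨K.levelMap n x, x.2.2⟩ : c) := by
      refine IsEmbedding.of_comp ?_ continuous_subtype_val ?_
      · exact ((K.continuous_levelMap n).comp continuous_subtype_val).subtype_mk _
      · exact h0.comp (IsEmbedding.inclusion inter_subset_left)
    convert (R.φ_cellHomeo.isEmbedding k c hc).comp h1 using 1
    funext x
    exact K.levelMap_succ n x

theorem injOn_levelMap (he : e ∈ K.cells n) : InjOn (K.levelMap n) e := fun x hx y hy hxy =>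
  congrArg Subtype.val ((isEmbedding_levelMap he).injective (a₁ := ⟨x, hx⟩) (a₂ := ⟨y, hy⟩) hxy)

theorem exists_mem_cells (n : ℕ) (x : K.X) : ∃ e ∈ K.cells n, x ∈ e := by
  induction n with
  | zero =>
    obtain ⟨k, e, he, hx⟩ := exists_mem_openCells (c := K.cw) (mem_univ x)
    exact ⟨e, ⟨k, he⟩, hx⟩
  | succ n ih =>
    obtain ⟨e₀, he₀, hx⟩ := ih
    obtain ⟨k, c, hc, hxc⟩ := exists_mem_openCells (c := R.sub) (mem_univ (K.levelMap n x))
    obtain ⟨l, c', hc', hcc'⟩ := R.sub_refines k c hc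
    obtain ⟨l', hl'⟩ := exists_image_mem_openCells he₀
    have := (openCells_unique hc' hl' (hcc' hxc) (mem_image_of_mem _ hx)).2
    exact ⟨_, ⟨e₀, he₀, k, c, hc, this ▸ hcc', rfl⟩, hx, hxc⟩

theorem cells_unique : ∀ {n : ℕ} {e e' : Set K.X}, e ∈ K.cells n → e' ∈ K.cells n →
    ∀ {x : K.X}, x ∈ e → x ∈ e' → e = e'
  | 0, _, _, ⟨_, hk⟩, ⟨_, hl⟩, _, hx, hx' => (openCells_unique hk hl hx hx').2
  | n + 1, _, _, ⟨e₀, he₀, k, c, hc, hce, h⟩, ⟨e₁, he₁, l, c', hc', hce', h'⟩, x, hx, hx' => by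
    subst h h'
    rw [cells_unique he₀ he₁ hx.1 hx'.1, (openCells_unique hc hc' hx.2 hx'.2).2]

theorem exists_parent (he : e ∈ K.cells (n + 1)) : ∃ e₀ ∈ K.cells n, e ⊆ e₀ := by
  obtain ⟨e₀, he₀, k, c, hc, hce, rfl⟩ := he
  exact ⟨e₀, he₀, inter_subset_left⟩

theorem cells_nonempty (he : e ∈ K.cells n) : e.Nonempty :=
  (exists_image_mem_openCells he).elim fun _ h => (openCells_nonempty h).of_image

theorem exists_ancestor (hnm : n ≤ m) (he : e ∈ K.cells m) : ∃ e₀ ∈ K.cells n, e ⊆ e₀ := by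
  induction m, hnm using Nat.le_induction generalizing e with
  | base => exact ⟨e, he, subset_rfl⟩
  | succ m _ ih =>
    obtain ⟨e₁, he₁, h1⟩ := exists_parent he
    obtain ⟨e₀, he₀, h0⟩ := ih he₁
    exact ⟨e₀, he₀, h1.trans h0⟩

theorem subset_of_mem (hnm : n ≤ m) (he : e ∈ K.cells m) (he' : e' ∈ K.cells n) {x : K.X}
    (hx : x ∈ e) (hx' : x ∈ e') : e ⊆ e' := by
  obtain ⟨e₀, he₀, h⟩ := exists_ancestor hnm he
  exact cells_unique he₀ he' (h hx) hx' ▸ h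

theorem finite_cells (hK : K.IsFinite) (n : ℕ) : (K.cells n).Finite := by
  induction n with
  | zero => exact finite_openCells hK
  | succ n ih =>
    refine (Set.Finite.image2 (fun e c => e ∩ K.levelMap n ⁻¹' c) ih
      (finite_openCells R.finite_sub)).subset ?_
    rintro _ ⟨e₀, he₀, k, c, hc, -, rfl⟩
    exact ⟨e₀, he₀, c, ⟨k, hc⟩, rfl⟩

theorem cells_isPreconnected (he : e ∈ K.cells n) : IsPreconnected e := by
  obtain ⟨k, hk⟩ := exists_image_mem_openCells he
  have h := openCells_isPreconnected hk
  have h2 := isEmbedding_levelMap he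
  rw [← Subtype.range_coe (s := e)]
  have h3 : IsPreconnected (univ : Set e) := by
    rw [← h2.isInducing.isPreconnected_image]
    rwa [image_univ, range_domRestrict]
  rw [← image_univ]
  exact h3.image _ continuous_subtype_val.continuousOn

/-- Distinct cells with the same image in `S_R` are separated. -/
theorem disjoint_closure : ∀ {n : ℕ} {e e' : Set K.X}, e ∈ K.cells n → e' ∈ K.cells n → e ≠ e' →
    K.levelMap n '' e = K.levelMap n '' e' → Disjoint (closure e) e'
  | 0, e, e', ⟨k, hk⟩, ⟨l, hl⟩, hne, heq => by
    obtain ⟨x, hx⟩ := openCells_nonempty hk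
    have hkl : k = l := by
      have h1 := K.f_cellHomeo.image_mem k e hk
      have h2 := K.f_cellHomeo.image_mem l e' hl
      obtain ⟨y, hy⟩ := openCells_nonempty h1
      exact (openCells_unique h1 h2 hy (heq.subset hy)).1
    rw [disjoint_left]
    intro y hy hy'
    exact (openCells_lt_of_mem_closure hk hl hne hy hy').ne hkl.symm
  | n + 1, _, _, ⟨e₀, he₀, k, c, hc, hce, h⟩, ⟨e₁, he₁, l, c', hc', hce', h'⟩, hne, heq => by
    subst h h'
    rw [image_succ n hce, image_succ n hce'] at heq
    have hkl : k = l := by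
      have h1 := R.φ_cellHomeo.image_mem k c hc
      have h2 := R.φ_cellHomeo.image_mem l c' hc'
      obtain ⟨y, hy⟩ := openCells_nonempty h1
      exact (openCells_unique h1 h2 hy (heq.subset hy)).1
    subst hkl
    -- If both cells pull back the same subcell, their parents are distinct with equal images and
    -- the induction hypothesis applies. Otherwise the two subcells have equal dimension and are
    -- already separated in `S_R`.
    by_cases hcc : c = c'
    · subst hcc
      have h01 : e₀ ≠ e₁ := fun h => hne (by rw [h])
      refine (disjoint_closure he₀ he₁ h01 ?_).mono (closure_mono inter_subset_left)
        inter_subset_left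
      obtain ⟨y, hy⟩ := openCells_nonempty hc
      obtain ⟨k₀, hk₀⟩ := exists_image_mem_openCells he₀
      obtain ⟨k₁, hk₁⟩ := exists_image_mem_openCells he₁
      exact (openCells_unique hk₀ hk₁ (hce hy) (hce' hy)).2
    · rw [disjoint_left]
      intro y hy hy'
      have : K.levelMap n y ∈ closure c :=
        map_mem_closure (K.continuous_levelMap n) hy fun z hz => hz.2
      exact (openCells_lt_of_mem_closure hc hc' hcc this hy'.2).ne rfl

/-- The tiles of `R(S_R)` are dense in each open tile of `S_R`, and a tile of `R^n(X)` embeds onto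
such a tile, so density passes to the next level. -/
theorem dense_tiles (n : ℕ) : Dense (K.levelMap n ⁻¹' R.tileRegion) := by
  induction n with
  | zero =>
    refine K.pure_cw.dense.mono ?_
    simp only [iUnion_subset_iff]
    exact fun e he x hx => mem_tileRegion.2 ⟨_, K.f_cellHomeo.image_mem d e he, mem_image_of_mem _ hx⟩
  | succ n ih =>
    refine dense_iff_closure_eq.2 (eq_univ_of_univ_subset ?_)
    rw [← ih.closure_eq]
    refine closure_minimal (fun x hx => ?_) isClosed_closure
    obtain ⟨e, he, hxe⟩ := exists_mem_cells n x
    obtain ⟨k, hk⟩ := exists_image_mem_openCells he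
    obtain ⟨t, ht, hxt⟩ := mem_tileRegion.1 hx
    have hkd := openCells_unique hk ht (mem_image_of_mem _ hxe) hxt
    have hopen : IsOpen (K.levelMap n '' e) := hkd.2 ▸ R.pure_cw.isOpen R.finite_cw ht
    rw [_root_.mem_closure_iff]
    intro U hU hxU
    obtain ⟨W, hW, hWU⟩ := (isEmbedding_levelMap he).isInducing.isOpen_iff.1
      (hU.preimage (continuous_subtype_val (p := (· ∈ e))))
    have hWU' : ∀ z ∈ e, K.levelMap n z ∈ W ↔ z ∈ U := fun z hz =>
      Set.ext_iff.1 hWU ⟨z, hz⟩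
    obtain ⟨y, ⟨hyW, z, hz, rfl⟩, hy⟩ := R.pure_sub.dense.inter_open_nonempty _ (hW.inter hopen)
      ⟨K.levelMap n x, (hWU' x hxe).2 hxU, mem_image_of_mem _ hxe⟩
    simp only [mem_iUnion] at hy
    obtain ⟨c, hc, hy⟩ := hy
    refine ⟨z, (hWU' z hz).1 hyW, mem_tileRegion.2 ⟨_, R.φ_cellHomeo.image_mem d c hc, ?_⟩⟩
    rw [levelMap_succ]
    exact mem_image_of_mem _ hy

theorem finite_fiber (hK : K.IsFinite) (n : ℕ) (y : R.S) : (K.levelMap n ⁻¹' {y}).Finite := by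
  have : K.levelMap n ⁻¹' {y} ⊆ ⋃ e ∈ K.cells n, e ∩ K.levelMap n ⁻¹' {y} := by
    intro x hx
    obtain ⟨e, he, hxe⟩ := exists_mem_cells n x
    exact mem_biUnion he ⟨hxe, hx⟩
  refine ((finite_cells hK n).biUnion fun e he => Set.Subsingleton.finite ?_).subset this
  intro a ha b hb
  exact injOn_levelMap he ha.1 hb.1 (ha.2.trans hb.2.symm)

theorem mem_closure_tile (hK : K.IsFinite) (n : ℕ) (x : K.X) :
    ∃ e ∈ K.cells n, K.levelMap n '' e ∈ openCells R.cw d ∧ x ∈ closure e := by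
  have h : K.levelMap n ⁻¹' R.tileRegion ⊆
      ⋃ e ∈ {e ∈ K.cells n | K.levelMap n '' e ∈ openCells R.cw d}, closure e := by
    intro y hy
    obtain ⟨e, he, hye⟩ := exists_mem_cells n y
    obtain ⟨k, hk⟩ := exists_image_mem_openCells he
    obtain ⟨t, ht, hyt⟩ := mem_tileRegion.1 hy
    refine mem_biUnion (x := e) ⟨he, ?_⟩ (subset_closure hye)
    exact (openCells_unique hk ht (mem_image_of_mem _ hye) hyt).2 ▸ ht
  have hc : IsClosed (⋃ e ∈ {e ∈ K.cells n | K.levelMap n '' e ∈ openCells R.cw d}, closure e) :=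
    ((finite_cells hK n).subset fun e he => he.1).isClosed_biUnion fun _ _ => isClosed_closure
  have := closure_minimal h hc (dense_tiles n x)
  simp only [mem_iUnion] at this
  obtain ⟨e, he, hx⟩ := this
  exact ⟨e, he.1, he.2, hx⟩

/-- Closed cells of `R^n(X)` are unions of open cells. -/
theorem subset_closure_of_mem (hK : K.IsFinite) (he : e ∈ K.cells n) (he' : e' ∈ K.cells n)
    {x : K.X} (hx : x ∈ closure e) (hx' : x ∈ e') : e' ⊆ closure e := by
  have : CompactSpace K.X := compactSpace_of_finite_cells hK
  obtain ⟨y, hy⟩ := cells_nonempty he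
  obtain ⟨t, ht, htd, hyt⟩ := mem_closure_tile hK n y
  obtain ⟨i, hi⟩ := htd
  obtain ⟨s, hs, -, hsc, hsi⟩ := R.polyhedral i
  -- The lift `g` serves as a characteristic map of the tile `t` of `R^n(X)`; through it the cell
  -- structure `s` of the disk describes the closure of `t`.
  obtain ⟨g, hg, hgt, hFg⟩ := exists_lift_closedBall (K.continuous_levelMap n) (finite_fiber hK n)
    (isEmbedding_levelMap ht) (R.cw.continuousOn d i) hi.symm
  have hDc : IsCompact (closedBall (0 : Fin d → ℝ) 1) := isCompact_closedBall _ _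
  have hcl : ∀ a ⊆ closedBall (0 : Fin d → ℝ) 1, g '' closure a = closure (g '' a) := by
    intro a ha
    have hac : closure a ⊆ closedBall 0 1 := closure_minimal ha isClosed_closedBall
    refine Subset.antisymm ?_ ?_
    · exact (hg.mono hac).image_closure
    · refine closure_minimal (image_mono subset_closure) ?_
      exact ((hDc.of_isClosed_subset isClosed_closure hac).image_of_continuousOn
        (hg.mono hac)).isClosed
  have hcell : ∀ k, ∀ a ∈ openCells s k, g '' a ∈ K.cells n := by
    intro k a ha
    have haD := openCells_subset ha
    have him : K.levelMap n '' (g '' a) = R.cw.map d i '' a := by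
      rw [← image_comp]
      exact image_congr fun z hz => hFg z (haD hz)
    obtain ⟨z, hz⟩ := openCells_nonempty ha
    have hpre : IsPreconnected (g '' a) := (openCells_isPreconnected ha).image _ (hg.mono haD)
    obtain ⟨b, hb, hzb⟩ := exists_mem_cells n (g z)
    have hca := (hsc k a ha).1
    have himg : ∀ b' ∈ K.cells n, ∀ z' ∈ a, g z' ∈ b' → K.levelMap n '' b' = R.cw.map d i '' a := by
      intro b' hb' z' hz' hzb'
      obtain ⟨l, hl⟩ := exists_image_mem_openCells hb'
      refine (openCells_unique hl hca (mem_image_of_mem _ hzb') ?_).2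
      rw [hFg z' (haD hz')]
      exact mem_image_of_mem _ hz'
    have hbz := himg b hb z hz hzb
    -- The connected set `g '' a` is covered by cells with one common image in `S_R`. Such cells are
    -- mutually separated by `disjoint_closure`, so only `b` can occur.
    set Q := {b' ∈ K.cells n | b' ≠ b ∧ K.levelMap n '' b' = K.levelMap n '' b} with hQ
    have hQc : IsClosed (⋃ b' ∈ Q, closure b') :=
      ((finite_cells hK n).subset fun _ h => h.1).isClosed_biUnion fun _ _ => isClosed_closure
    have hsub : ∀ w ∈ g '' a, w ∈ b ∨ ∃ b' ∈ Q, w ∈ b' := by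
      rintro _ ⟨w, hw, rfl⟩
      obtain ⟨b', hb', hwb'⟩ := exists_mem_cells n (g w)
      by_cases hbb : b' = b
      · exact Or.inl (hbb ▸ hwb')
      · exact Or.inr ⟨b', ⟨hb', hbb, (himg b' hb' w hw hwb').trans hbz.symm⟩, hwb'⟩
    have hb_disj : ∀ w ∈ b, w ∉ ⋃ b' ∈ Q, closure b' := by
      intro w hw hw'
      simp only [mem_iUnion] at hw'
      obtain ⟨b', hb', hw'⟩ := hw'
      exact disjoint_left.1 (disjoint_closure hb'.1 hb hb'.2.1 hb'.2.2) hw' hw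
    have hsubset : g '' a ⊆ b := by
      intro w hw
      by_contra hwb
      obtain ⟨b', hb', hwb'⟩ := (hsub w hw).resolve_left hwb
      obtain ⟨v, hv, hv1, hv2⟩ := hpre (⋃ b' ∈ Q, closure b')ᶜ (closure b)ᶜ hQc.isOpen_compl
        isClosed_closure.isOpen_compl (fun v hv => (hsub v hv).imp (hb_disj v) fun ⟨b', hb', hvb'⟩ hvb =>
          disjoint_left.1 (disjoint_closure hb hb'.1 hb'.2.1.symm hb'.2.2.symm) hvb hvb')
        ⟨g z, mem_image_of_mem _ hz, hb_disj _ hzb⟩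
        ⟨w, hw, fun hwb => disjoint_left.1 (disjoint_closure hb hb'.1 hb'.2.1.symm hb'.2.2.symm)
          hwb hwb'⟩
      rcases hsub v hv with h | ⟨b', hb', h⟩
      · exact hv2 (subset_closure h)
      · exact hv1 (mem_biUnion hb' (subset_closure h))
    have : g '' a = b := by
      refine hsubset.antisymm fun w hw => ?_
      obtain ⟨w', hw', hww'⟩ : K.levelMap n w ∈ K.levelMap n '' (g '' a) := by
        rw [him, ← hbz]
        exact mem_image_of_mem _ hw
      exact injOn_levelMap hb (hsubset hw') hw hww' ▸ hw'
    exact this ▸ hb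
  have hcover : ∀ a ⊆ closedBall (0 : Fin d → ℝ) 1, ∀ x ∈ closure (g '' a),
      ∃ k, ∃ b ∈ openCells s k, ∃ z ∈ b, z ∈ closure a ∧ g z = x := by
    intro a ha x hx
    rw [← hcl a ha] at hx
    obtain ⟨z, hz, rfl⟩ := hx
    obtain ⟨k, b, hb, hzb⟩ := exists_mem_openCells (c := s)
      (closure_minimal ha isClosed_closedBall hz)
    exact ⟨k, b, hb, z, hzb, hz, rfl⟩
  -- Both `e` and `e'` are images of cells of the disk, where the incidence statement is
  -- `subset_closure_of_inter_eq_closure`.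
  obtain ⟨k, a, ha, z, hza, -, hzy⟩ := hcover _ ball_subset_closedBall y (hgt ▸ hyt)
  have hae : g '' a = e := cells_unique (hcell k a ha) he (mem_image_of_mem _ hza) (hzy ▸ hy)
  rw [← hae] at hx
  obtain ⟨l, b, hb, w, hwb, hwa, hwx⟩ := hcover a (openCells_subset ha) x hx
  have hbe : g '' b = e' := cells_unique (hcell l b hb) he' (mem_image_of_mem _ hwb) (hwx ▸ hx')
  rw [← hae, ← hbe, ← hcl a (openCells_subset ha)]
  exact image_mono (subset_closure_of_inter_eq_closure hsi ha hb hwa hwb)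

end RComplex

/-! ### Nested intersections, the limit set, and components of the level graphs. -/

theorem isPreconnected_iInter_of_antitone {X : Type u} [TopologicalSpace X] [CompactSpace X]
    [T2Space X] {s : ℕ → Set X} (hs : Antitone s) (hc : ∀ n, IsClosed (s n))
    (hp : ∀ n, IsPreconnected (s n)) : IsPreconnected (⋂ n, s n) := by
  rw [isPreconnected_iff_subset_of_fully_disjoint_closed (isClosed_iInter hc)]
  intro u v hu hv hsub huv
  obtain ⟨U, W, hU, hW, huU, hvW, hUW⟩ := SeparatedNhds.of_isCompact_isCompact hu.isCompact
    hv.isCompact huv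
  obtain ⟨n, hn⟩ := exists_subset_nhds_of_compactSpace (directed_of_isDirected_le hs) hc
    (U := U ∪ W) fun x hx => (hU.union hW).mem_nhds (union_subset_union huU hvW (hsub hx))
  have key : ∀ {A B u v : Set X}, Disjoint A B → v ⊆ B → s n ⊆ A → (⋂ n, s n) ⊆ u ∪ v →
      (⋂ n, s n) ⊆ u := by
    intro A B u v hAB hvB hA hsub x hx
    exact (hsub hx).resolve_right fun hxv =>
      disjoint_left.1 hAB (hA (mem_iInter.1 hx n)) (hvB hxv)
  by_cases hne : (s n ∩ U).Nonempty
  · exact Or.inl (key hUW hvW ((hp n).subset_left_of_subset_union hU hW hUW hn hne) hsub)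
  · refine Or.inr (key hUW.symm huU (fun x hx => (hn hx).resolve_left fun hxU => hne ⟨x, hx, hxU⟩)
      (union_comm u v ▸ hsub))

namespace RComplex

open SubdivisionRule

variable {d : ℕ} {R : SubdivisionRule.{u} d} {K : RComplex.{u, v} R} {n m : ℕ}

/-! ### The limit set -/

theorem mem_nonIdealTiles_of_mem {e : Set K.X} (he : e ∈ K.cells n) {x : K.X} (hx : x ∈ e)
    (hV : K.levelMap n x ∈ R.nonIdealRegion) : e ∈ K.nonIdealTiles n := by
  obtain ⟨t, ht, hxt⟩ := mem_nonIdealRegion.1 hV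
  obtain ⟨k, hk⟩ := exists_image_mem_openCells he
  have := (openCells_unique hk ht.1 (mem_image_of_mem _ hx) hxt).2
  exact ⟨he, this ▸ ht.1, this ▸ ht.2⟩

theorem biUnion_nonIdealTiles (n : ℕ) :
    ⋃ e ∈ K.nonIdealTiles n, e = K.levelMap n ⁻¹' R.nonIdealRegion := by
  ext x
  simp only [mem_iUnion, exists_prop]
  constructor
  · rintro ⟨e, ⟨-, h1, h2⟩, hx⟩
    exact mem_nonIdealRegion.2 ⟨_, ⟨h1, h2⟩, mem_image_of_mem _ hx⟩
  · intro hx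
    obtain ⟨e, he, hxe⟩ := exists_mem_cells n x
    exact ⟨e, mem_nonIdealTiles_of_mem he hxe hx, hxe⟩

theorem limitLevel_eq_closure (hK : K.IsFinite) (n : ℕ) :
    K.limitLevel n = closure (K.levelMap n ⁻¹' R.nonIdealRegion) := by
  rw [← biUnion_nonIdealTiles,
    ((finite_cells hK n).subset fun e he => he.1 : (K.nonIdealTiles n).Finite).closure_biUnion]
  rfl

theorem isClosed_limitLevel (hK : K.IsFinite) (n : ℕ) : IsClosed (K.limitLevel n) :=
  limitLevel_eq_closure hK n ▸ isClosed_closure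

theorem limitLevel_antitone (hK : K.IsFinite) : Antitone K.limitLevel :=
  antitone_nat_of_succ_le fun n => by
    rw [limitLevel_eq_closure hK, limitLevel_eq_closure hK]
    refine closure_mono fun x hx => mem_nonIdealRegion_of_map ?_
    rw [← levelMap_succ]
    exact hx

/-- Closed tiles cover `X`, so a point outside the closed ideal tiles lies in a closed non-ideal
one. Conversely, open non-ideal tiles are disjoint from closed ideal tiles. -/
theorem compl_interior_idealTiles (hK : K.IsFinite) (n : ℕ) :
    (interior (⋃ e ∈ K.idealTiles n, closure e))ᶜ = K.limitLevel n := by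
  rw [← closure_compl]
  refine Subset.antisymm (closure_minimal (fun x hx => ?_) (isClosed_limitLevel hK n)) ?_
  · obtain ⟨e, he, hed, hxe⟩ := mem_closure_tile hK n x
    refine mem_biUnion (x := e) ⟨he, hed, fun hi => hx ?_⟩ hxe
    exact mem_biUnion (x := e) ⟨he, hi⟩ hxe
  · rw [limitLevel_eq_closure hK]
    refine closure_mono fun x hx hx' => ?_
    simp only [mem_iUnion] at hx'
    obtain ⟨e, he, hxe⟩ := hx'
    obtain ⟨y, hy, hye⟩ := _root_.mem_closure_iff.1 hxe _
      (R.isOpen_nonIdealRegion.preimage (K.continuous_levelMap n)) hx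
    exact disjoint_left.1 R.disjoint_idealRegion_nonIdealRegion
      (mem_idealRegion.2 ⟨_, he.2, mem_image_of_mem _ hye⟩) hy

theorem limitSet_eq_iInter (hK : K.IsFinite) : K.limitSet = ⋂ n, K.limitLevel n := by
  rw [limitSet, idealSet, compl_iUnion]
  exact iInter_congr fun n => compl_interior_idealTiles hK n

theorem limitSet_subset (hK : K.IsFinite) (n : ℕ) : K.limitSet ⊆ K.limitLevel n :=
  limitSet_eq_iInter hK ▸ iInter_subset _ n

/-! ### Vertices of the level graphs -/

theorem subset_limitLevel (hK : K.IsFinite) {e : Set K.X} (he : e ∈ K.cells n) {x : K.X}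
    (hx : x ∈ e) (hxL : x ∈ K.limitLevel n) : e ⊆ K.limitLevel n := by
  simp only [limitLevel, mem_iUnion] at hxL
  obtain ⟨t, ht, hxt⟩ := hxL
  exact (subset_closure_of_mem hK ht.1 he hxt hx).trans
    (subset_biUnion_of_mem (u := fun e => closure e) ht)

theorem exists_vertex (hK : K.IsFinite) {x : K.X} (hx : x ∈ K.limitLevel n) :
    ∃ a : K.LevelVertex n, x ∈ a.1 := by
  obtain ⟨e, he, hxe⟩ := exists_mem_cells n x
  exact ⟨⟨e, he, subset_limitLevel hK he hxe hx⟩, hxe⟩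

theorem vertex_nonempty (a : K.LevelVertex n) : a.1.Nonempty := cells_nonempty a.2.1

theorem vertex_unique {a b : K.LevelVertex n} {x : K.X} (ha : x ∈ a.1) (hb : x ∈ b.1) : a = b :=
  Subtype.ext (cells_unique a.2.1 b.2.1 ha hb)

theorem finite_levelVertex (hK : K.IsFinite) (n : ℕ) : Finite (K.LevelVertex n) :=
  ((finite_cells hK n).subset fun _ h => h.1 :
    {e | e ∈ K.cells n ∧ e ⊆ K.limitLevel n}.Finite).to_subtype

theorem exists_vertex_ancestor (hK : K.IsFinite) (hnm : n ≤ m) (b : K.LevelVertex m) :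
    ∃ a : K.LevelVertex n, b.1 ⊆ a.1 := by
  obtain ⟨x, hx⟩ := vertex_nonempty b
  obtain ⟨a, ha⟩ := exists_vertex hK (limitLevel_antitone hK hnm (b.2.2 hx))
  exact ⟨a, subset_of_mem hnm b.2.1 a.2.1 hx ha⟩

theorem levelGraph_adj {a b : K.LevelVertex n} : (K.levelGraph n).Adj a b ↔
    a ≠ b ∧ (closure a.1 ⊆ closure b.1 ∨ closure b.1 ⊆ closure a.1) :=
  SimpleGraph.fromRel_adj _ _ _

theorem eq_or_adj_of_mem_closure (hK : K.IsFinite) {a b : K.LevelVertex n} {x : K.X}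
    (ha : x ∈ a.1) (hb : x ∈ closure b.1) : a = b ∨ (K.levelGraph n).Adj a b := by
  refine or_iff_not_imp_left.2 fun hne => levelGraph_adj.2 ⟨hne, Or.inl ?_⟩
  exact closure_minimal (subset_closure_of_mem hK b.2.1 a.2.1 hb ha) isClosed_closure

theorem reachable_of_mem_closure (hK : K.IsFinite) {a b : K.LevelVertex n} {x : K.X}
    (ha : x ∈ a.1) (hb : x ∈ closure b.1) : (K.levelGraph n).Reachable a b := by
  rcases eq_or_adj_of_mem_closure hK ha hb with rfl | h
  · exact SimpleGraph.Reachable.refl _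
  · exact h.reachable

theorem isPreconnected_closure_vertex (a : K.LevelVertex n) : IsPreconnected (closure a.1) :=
  (cells_isPreconnected a.2.1).closure

theorem closure_vertex_subset (hK : K.IsFinite) (a : K.LevelVertex n) :
    closure a.1 ⊆ K.limitLevel n :=
  closure_minimal a.2.2 (isClosed_limitLevel hK n)

/-- A preconnected subset of `Λ_n` only meets cells in one component of `Γ_n`. -/
theorem reachable_of_isPreconnected (hK : K.IsFinite) {s : Set K.X} (hs : IsPreconnected s)
    (hsL : s ⊆ K.limitLevel n) {a b : K.LevelVertex n} {x y : K.X} (hx : x ∈ s) (hy : y ∈ s)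
    (hxa : x ∈ a.1) (hyb : y ∈ b.1) : (K.levelGraph n).Reachable a b := by
  have := finite_levelVertex hK n
  by_contra hab
  have hcl : ∀ P : K.LevelVertex n → Prop, IsClosed (⋃ c ∈ {c | P c}, closure c.1) := fun P =>
    (toFinite {c | P c}).isClosed_biUnion fun _ _ => isClosed_closure
  -- The closed cells reachable from `a` and the unreachable ones form two closed sets covering `s`.
  -- A common point lies in an open cell connected to both sides.
  obtain ⟨z, hz, hz1, hz2⟩ := (isPreconnected_closed_iff.1 hs) _ _
    (hcl fun c => (K.levelGraph n).Reachable a c) (hcl fun c => ¬ (K.levelGraph n).Reachable a c)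
    (fun z hz => by
      obtain ⟨c, hc⟩ := exists_vertex hK (hsL hz)
      by_cases h : (K.levelGraph n).Reachable a c
      · exact Or.inl (mem_biUnion (x := c) h (subset_closure hc))
      · exact Or.inr (mem_biUnion (x := c) h (subset_closure hc)))
    ⟨x, hx, mem_biUnion (x := a) (SimpleGraph.Reachable.refl a) (subset_closure hxa)⟩
    ⟨y, hy, mem_biUnion (x := b) hab (subset_closure hyb)⟩
  simp only [mem_iUnion] at hz1 hz2
  obtain ⟨c₁, h1, hz1⟩ := hz1
  obtain ⟨c₂, h2, hz2⟩ := hz2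
  obtain ⟨c, hc⟩ := exists_vertex hK (hsL hz)
  exact h2 ((h1 : (K.levelGraph n).Reachable a c₁).trans
    ((reachable_of_mem_closure hK hc hz1).symm.trans (reachable_of_mem_closure hK hc hz2)))

theorem connectedComponentIn_eq_of_reachable (hK : K.IsFinite) {a b : K.LevelVertex n}
    (h : (K.levelGraph n).Reachable a b) {x y : K.X} (hx : x ∈ a.1) (hy : y ∈ b.1) :
    connectedComponentIn (K.limitLevel n) x = connectedComponentIn (K.limitLevel n) y := by
  have hsub : ∀ {a b : K.LevelVertex n}, closure a.1 ⊆ closure b.1 → ∀ {x y}, x ∈ a.1 → y ∈ b.1 →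
      connectedComponentIn (K.limitLevel n) x = connectedComponentIn (K.limitLevel n) y := by
    intro a b hab x y hx hy
    refine connectedComponentIn_eq ?_
    exact (isPreconnected_closure_vertex b).subset_connectedComponentIn
      (hab (subset_closure hx)) (closure_vertex_subset hK b) (subset_closure hy)
  obtain ⟨p⟩ := h
  induction p generalizing x with
  | nil => exact hsub subset_rfl hx hy
  | @cons u v w hadj p ih =>
    obtain ⟨z, hz⟩ := vertex_nonempty v
    rw [← ih hz hy]
    rcases (levelGraph_adj.1 hadj).2 with h | h
    · exact hsub h hx hz
    · exact (hsub h hz hx).symm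

theorem sameComponent_iff_reachable (hK : K.IsFinite) {a b : K.LevelVertex n} :
    K.SameComponent n a b ↔ (K.levelGraph n).Reachable a b := by
  constructor
  · rintro ⟨x, hx, ha, hb⟩
    obtain ⟨y, hy⟩ := vertex_nonempty a
    obtain ⟨z, hz⟩ := vertex_nonempty b
    exact reachable_of_isPreconnected hK isPreconnected_connectedComponentIn
      (connectedComponentIn_subset _ _) (ha hy) (hb hz) hy hz
  · intro h
    obtain ⟨y, hy⟩ := vertex_nonempty a
    obtain ⟨z, hz⟩ := vertex_nonempty b
    refine ⟨y, a.2.2 hy, (cells_isPreconnected a.2.1).subset_connectedComponentIn hy a.2.2, ?_⟩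
    rw [connectedComponentIn_eq_of_reachable hK h hy hz]
    exact (cells_isPreconnected b.2.1).subset_connectedComponentIn hz b.2.2

/-- Two points of the limit set lie in the same component if and only if their cells lie in the same
component at every level. -/
theorem connectedComponents_eq_iff (hK : K.IsFinite) (p q : K.limitSet) :
    (p : ConnectedComponents K.limitSet) = q ↔ ∀ (n : ℕ) (a b : K.LevelVertex n),
      p.1 ∈ a.1 → q.1 ∈ b.1 → (K.levelGraph n).Reachable a b := by
  have : CompactSpace K.X := compactSpace_of_finite_cells hK
  rw [ConnectedComponents.coe_eq_coe]
  constructor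
  · intro h n a b ha hb
    have hq : q ∈ connectedComponent p := h ▸ mem_connectedComponent
    refine reachable_of_isPreconnected hK (isPreconnected_connectedComponent.image Subtype.val
      continuous_subtype_val.continuousOn (s := connectedComponent p)) ?_
      (mem_image_of_mem _ mem_connectedComponent) (mem_image_of_mem _ hq) ha hb
    rintro _ ⟨z, -, rfl⟩
    exact limitSet_subset hK n z.2
  · intro h
    -- The components of `p` in the `Λ_n` are nested compact connected sets, so their intersection
    -- is a connected subset of `Λ` containing both points.
    set C : ℕ → Set K.X := fun n => connectedComponentIn (K.limitLevel n) p with hC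
    have hpC : ∀ n, p.1 ∈ C n := fun n => mem_connectedComponentIn (limitSet_subset hK n p.2)
    have hqC : ∀ n, q.1 ∈ C n := fun n => by
      obtain ⟨a, ha⟩ := exists_vertex hK (limitSet_subset hK n p.2)
      obtain ⟨b, hb⟩ := exists_vertex hK (limitSet_subset hK n q.2)
      have := connectedComponentIn_eq_of_reachable hK (h n a b ha hb) ha hb
      simp only [hC, this]
      exact mem_connectedComponentIn (limitSet_subset hK n q.2)
    have hanti : Antitone C := fun i j hij =>
      connectedComponentIn_mono _ (limitLevel_antitone hK hij)
    have hpre := isPreconnected_iInter_of_antitone hanti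
      (fun n => isClosed_of_closure_subset (isPreconnected_connectedComponentIn.closure
        |>.subset_connectedComponentIn (subset_closure (hpC n)) (closure_minimal
          (connectedComponentIn_subset _ _) (isClosed_limitLevel hK n))))
      (fun n => isPreconnected_connectedComponentIn)
    have hsub : (⋂ n, C n) ⊆ K.limitSet := by
      rw [limitSet_eq_iInter hK]
      exact iInter_mono fun n => connectedComponentIn_subset _ _
    have hpre' : IsPreconnected ((↑) ⁻¹' (⋂ n, C n) : Set K.limitSet) := by
      rw [← IsInducing.subtypeVal.isPreconnected_image, Subtype.image_preimage_coe,
        inter_eq_right.2 hsub]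
      exact hpre
    exact connectedComponent_eq (hpre'.subset_connectedComponent
      (show p ∈ _ from mem_iInter.2 hpC) (show q ∈ _ from mem_iInter.2 hqC))

/-- There is a number `N` such that the ancestor `N` levels up of any cell has distance at most two
from a cell that meets the limit set. -/
theorem exists_near_limitSet (hK : K.IsFinite) : ∃ N, ∀ (n : ℕ) (v : K.LevelVertex (n + N)),
    ∃ a t c : K.LevelVertex n, v.1 ⊆ a.1 ∧ (a = t ∨ (K.levelGraph n).Adj a t) ∧
      (c = t ∨ (K.levelGraph n).Adj c t) ∧ (c.1 ∩ K.limitSet).Nonempty := by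
  have : CompactSpace K.X := compactSpace_of_finite_cells hK
  obtain ⟨N, hN⟩ := R.exists_depth
  refine ⟨N, fun n v => ?_⟩
  obtain ⟨x, hx⟩ := vertex_nonempty v
  have hxL := v.2.2 hx
  simp only [limitLevel, mem_iUnion] at hxL
  obtain ⟨t, ht, hxt⟩ := hxL
  obtain ⟨t', ht', htt'⟩ := exists_ancestor (Nat.le_add_right n N) ht.1
  obtain ⟨y, hy⟩ := cells_nonempty ht.1
  have hyV : R.φ^[N] (K.levelMap n y) ∈ R.nonIdealRegion := by
    rw [← levelMap_add]
    exact mem_nonIdealRegion.2 ⟨_, ht.2, mem_image_of_mem _ hy⟩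
  have ht'V : t' ∈ K.nonIdealTiles n :=
    mem_nonIdealTiles_of_mem ht' (htt' hy) 
      (mem_nonIdealRegion_of_iterate (x := K.levelMap n y) (Nat.zero_le N) hyV)
  -- The tile `t'` has a non-ideal subtile `N` levels down, hence at every depth; compactness then
  -- produces a limit point in its closure.
  have hdepth := hN _ ht'V.2.1 ⟨_, mem_image_of_mem _ (htt' hy), hyV⟩
  have htL : closure t' ⊆ K.limitLevel n :=
    subset_biUnion_of_mem (u := fun e => closure e) ht'V
  obtain ⟨p, hp⟩ : (⋂ k, closure t' ∩ K.limitLevel (n + k)).Nonempty := by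
    refine IsCompact.nonempty_iInter_of_sequence_nonempty_isCompact_isClosed _ ?_ ?_ ?_ ?_
    · exact fun k => inter_subset_inter_right _ (limitLevel_antitone hK (Nat.le_succ _))
    · intro k
      obtain ⟨_, ⟨z, hz, rfl⟩, hzV⟩ := hdepth k
      refine ⟨z, subset_closure hz, ?_⟩
      rw [limitLevel_eq_closure hK]
      refine subset_closure ?_
      rwa [mem_preimage, levelMap_add]
    · exact (isClosed_closure.inter (isClosed_limitLevel hK _)).isCompact
    · exact fun k => isClosed_closure.inter (isClosed_limitLevel hK _)
  rw [mem_iInter] at hp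
  have hpL : p ∈ K.limitSet := by
    rw [limitSet_eq_iInter hK, mem_iInter]
    exact fun k => limitLevel_antitone hK (Nat.le_add_left k n) (hp k).2
  let tv : K.LevelVertex n := ⟨t', ht', subset_closure.trans htL⟩
  obtain ⟨a, hva⟩ := exists_vertex_ancestor hK (Nat.le_add_right n N) v
  obtain ⟨c, hc⟩ := exists_vertex hK (limitSet_subset hK n hpL)
  exact ⟨a, tv, c, hva, eq_or_adj_of_mem_closure hK (hva hx) (closure_mono htt' hxt),
    eq_or_adj_of_mem_closure hK hc (hp 0).1, p, hc, hpL⟩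

/-! ### Paths in the history graph -/

/-- The distance of a vertex of the history graph from the origin. -/
def level : K.HistoryVertex → ℕ
  | none => 0
  | some v => v.1 + 1

@[simp]
theorem level_none : level (none : K.HistoryVertex) = 0 := rfl

@[simp]
theorem level_some (a : K.LevelVertex n) : level (some ⟨n, a⟩ : K.HistoryVertex) = n + 1 := rfl

/-- The vertex `v` of the history graph is a cell contained in the cell `a` of `Γ_n`. -/
def Below (n : ℕ) (a : K.LevelVertex n) (v : K.HistoryVertex) : Prop :=
  ∃ m, ∃ b : K.LevelVertex m, v = some ⟨m, b⟩ ∧ n ≤ m ∧ b.1 ⊆ a.1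

theorem exists_below (hK : K.IsFinite) {v : K.HistoryVertex} (hv : n < level v) :
    ∃ a, Below n a v := by
  rcases v with _ | ⟨m, b⟩
  · exact (Nat.not_lt_zero _ hv).elim
  · have hnm : n ≤ m := Nat.lt_succ_iff.1 hv
    obtain ⟨a, ha⟩ := exists_vertex_ancestor hK hnm b
    exact ⟨a, m, b, rfl, hnm, ha⟩

theorem below_unique {a b : K.LevelVertex n} {v : K.HistoryVertex} (ha : Below n a v)
    (hb : Below n b v) : a = b := by
  obtain ⟨m, c, rfl, -, hc⟩ := ha
  obtain ⟨m', c', h, -, hc'⟩ := hb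
  cases h
  obtain ⟨x, hx⟩ := vertex_nonempty c
  exact vertex_unique (hc hx) (hc' hx)

theorem Below.level_lt {a : K.LevelVertex n} {v : K.HistoryVertex} (h : Below n a v) :
    n < level v := by
  obtain ⟨m, b, rfl, hnm, -⟩ := h
  exact Nat.lt_succ_of_le hnm

theorem historyGraph_adj {x y : K.HistoryVertex} :
    K.historyGraph.Adj x y ↔ x ≠ y ∧ (K.HistoryEdge x y ∨ K.HistoryEdge y x) :=
  SimpleGraph.fromRel_adj _ _ _

theorem level_le_of_adj {x y : K.HistoryVertex} (h : K.historyGraph.Adj x y) :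
    level y ≤ level x + 1 := by
  rcases (historyGraph_adj.1 h).2 with h | h <;> cases h <;> simp [level]

theorem eq_or_adj_of_below (hK : K.IsFinite) {a b : K.LevelVertex n} {x y : K.HistoryVertex}
    (h : K.historyGraph.Adj x y) (ha : Below n a x) (hb : Below n b y) :
    a = b ∨ (K.levelGraph n).Adj a b := by
  have key : ∀ {a b : K.LevelVertex n} {x y : K.HistoryVertex}, K.HistoryEdge x y → Below n a x →
      Below n b y → a = b ∨ (K.levelGraph n).Adj a b := by
    intro a b x y h ha hb
    cases h with
    | origin c => exact (Nat.not_lt_zero _ ha.level_lt).elim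
    | horizontal m c c' h =>
      obtain ⟨_, _, h1, -, hca⟩ := ha
      obtain ⟨_, _, h2, -, hcb⟩ := hb
      cases h1
      cases h2
      rcases (levelGraph_adj.1 h).2 with h | h
      · obtain ⟨z, hz⟩ := vertex_nonempty c
        exact eq_or_adj_of_mem_closure hK (hca hz) (closure_mono hcb (h (subset_closure hz)))
      · obtain ⟨z, hz⟩ := vertex_nonempty c'
        exact (eq_or_adj_of_mem_closure hK (hcb hz)
          (closure_mono hca (h (subset_closure hz)))).imp Eq.symm fun h => h.symm
    | vertical m c c' h =>
      obtain ⟨_, _, h1, -, hca⟩ := ha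
      obtain ⟨_, _, h2, -, hcb⟩ := hb
      cases h1
      cases h2
      obtain ⟨z, hz⟩ := vertex_nonempty c'
      exact Or.inl (vertex_unique (hca (h hz)) (hcb hz))
  rcases (historyGraph_adj.1 h).2 with h | h
  · exact key h ha hb
  · exact (key h hb ha).imp Eq.symm fun h => h.symm

/-- Paths that stay below level `n` project to paths in `Γ_n`. -/
theorem edist_le_of_walk (hK : K.IsFinite) {x y : K.HistoryVertex} (p : K.historyGraph.Walk x y)
    (hp : ∀ z ∈ p.support, n < level z) {a b : K.LevelVertex n} (ha : Below n a x)
    (hb : Below n b y) : (K.levelGraph n).edist a b ≤ p.length := by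
  induction p generalizing a with
  | nil => simp [below_unique ha hb]
  | @cons x z y h p ih =>
    obtain ⟨c, hc⟩ := exists_below hK (hp z (by simp))
    have h1 : (K.levelGraph n).edist c b ≤ p.length :=
      ih (fun w hw => hp w (by simp [hw])) hc hb
    have h2 : (K.levelGraph n).edist a c ≤ 1 := by
      rw [SimpleGraph.edist_le_one_iff_adj_or_eq]
      exact (eq_or_adj_of_below hK h ha hc).symm
    refine (SimpleGraph.edist_triangle (v := c)).trans ((add_le_add h2 h1).trans ?_)
    simp [add_comm]

theorem level_le_of_walk {x y : K.HistoryVertex} (p : K.historyGraph.Walk x y) :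
    level y ≤ level x + p.length := by
  induction p with
  | nil => simp
  | cons h p ih =>
    have := level_le_of_adj h
    simp only [SimpleGraph.Walk.length_cons]
    omega

theorem level_le_of_mem_support {x y z : K.HistoryVertex} (p : K.historyGraph.Walk x y)
    (hz : z ∈ p.support) : level x ≤ level z + p.length := by
  classical
  have h1 := level_le_of_walk (p.takeUntil z hz).reverse
  have h2 := p.length_takeUntil_le_length hz
  rw [SimpleGraph.Walk.length_reverse] at h1
  omega

/-- A cell is joined to its ancestors by vertical paths. -/
theorem exists_vertical_walk (hK : K.IsFinite) (hnm : n ≤ m) {a : K.LevelVertex n}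
    {b : K.LevelVertex m} (h : b.1 ⊆ a.1) :
    ∃ p : K.historyGraph.Walk (some ⟨n, a⟩) (some ⟨m, b⟩), p.length = m - n ∧
      ∀ z ∈ p.support, n < level z := by
  induction m, hnm using Nat.le_induction with
  | base =>
    obtain ⟨x, hx⟩ := vertex_nonempty b
    obtain rfl := vertex_unique hx (h hx)
    exact ⟨SimpleGraph.Walk.nil, by simp, by simp [level]⟩
  | succ m hnm ih =>
    obtain ⟨c, hc⟩ := exists_vertex_ancestor hK (Nat.le_succ m) b
    obtain ⟨x, hx⟩ := vertex_nonempty b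
    obtain ⟨p, hp, hp'⟩ := ih (b := c) (subset_of_mem hnm c.2.1 a.2.1 (hc hx) (h hx))
    have hadj : K.historyGraph.Adj (some ⟨m, c⟩) (some ⟨m + 1, b⟩) :=
      historyGraph_adj.2 ⟨by simp, Or.inl (HistoryEdge.vertical m c b hc)⟩
    refine ⟨p.concat hadj, by rw [SimpleGraph.Walk.length_concat, hp]; omega, ?_⟩
    intro z hz
    rw [SimpleGraph.Walk.support_concat] at hz
    simp only [List.mem_append, List.mem_singleton] at hz
    rcases hz with hz | rfl
    · exact hp' z hz
    · simp only [level]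
      omega

/-- Paths in `Γ_n` are paths in the history graph. -/
theorem exists_horizontal_walk {a b : K.LevelVertex n} (p : (K.levelGraph n).Walk a b) :
    ∃ q : K.historyGraph.Walk (some ⟨n, a⟩) (some ⟨n, b⟩), q.length = p.length ∧
      ∀ z ∈ q.support, level z = n + 1 := by
  induction p with
  | nil => exact ⟨SimpleGraph.Walk.nil, rfl, by simp [level]⟩
  | @cons a c b h p ih =>
    obtain ⟨q, hq, hq'⟩ := ih
    have hadj : K.historyGraph.Adj (some ⟨n, a⟩) (some ⟨n, c⟩) := historyGraph_adj.2
      ⟨fun heq => h.ne (by simpa using heq), Or.inl (HistoryEdge.horizontal n a c h)⟩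
    refine ⟨SimpleGraph.Walk.cons hadj q, by simp [hq], fun z hz => ?_⟩
    rw [SimpleGraph.Walk.support_cons, List.mem_cons] at hz
    rcases hz with rfl | hz
    · rfl
    · exact hq' z hz

theorem exists_walk_origin (hK : K.IsFinite) (x : K.HistoryVertex) :
    ∃ p : K.historyGraph.Walk none x, p.length = level x := by
  rcases x with _ | ⟨n, b⟩
  · exact ⟨SimpleGraph.Walk.nil, rfl⟩
  · obtain ⟨a, ha⟩ := exists_vertex_ancestor hK (Nat.zero_le n) b
    obtain ⟨p, hp, -⟩ := exists_vertical_walk hK (Nat.zero_le n) ha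
    have hadj : K.historyGraph.Adj none (some ⟨0, a⟩) :=
      historyGraph_adj.2 ⟨by simp, Or.inl (HistoryEdge.origin a)⟩
    exact ⟨SimpleGraph.Walk.cons hadj p, by simp [level, hp]⟩

theorem historyGraph_connected (hK : K.IsFinite) : K.historyGraph.Connected := by
  have h : ∀ x, K.historyGraph.Reachable none x := fun x => ⟨(exists_walk_origin hK x).choose⟩
  exact { preconnected := fun x y => (h x).symm.trans (h y), nonempty := ⟨none⟩ }

theorem dist_origin (hK : K.IsFinite) (x : K.HistoryVertex) :
    K.historyGraph.dist none x = level x := by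
  obtain ⟨p, hp⟩ := exists_walk_origin hK x
  refine le_antisymm (hp ▸ SimpleGraph.dist_le p) ?_
  obtain ⟨q, hq⟩ := (historyGraph_connected hK).exists_walk_length_eq_dist none x
  have := level_le_of_walk q
  simpa [hq] using this

theorem dist_le_level_add_level (hK : K.IsFinite) (x y : K.HistoryVertex) :
    K.historyGraph.dist x y ≤ level x + level y := by
  have := (historyGraph_connected hK).dist_triangle (u := x) (v := none) (w := y)
  rwa [SimpleGraph.dist_comm (v := none), dist_origin hK, dist_origin hK] at this

end RComplex

/-! ### Graphs that are quasi-isometric to the line -/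

section CoarseHeight

variable {V : Type u} {G : SimpleGraph V} {o : V} {g : V → ℝ} {δ : ℝ} {B : ℕ}

/-- A function on the vertices of a graph that vanishes at `o` and looks coarsely like a
quasi-isometry to the line. -/
structure IsCoarseHeight (G : SimpleGraph V) (o : V) (g : V → ℝ) (δ : ℝ) (B : ℕ) : Prop where
  zero : g o = 0
  abs_sub_le : ∀ x y, G.Adj x y → |g x - g y| ≤ δ
  dist_le : ∀ x y, |g x - g y| ≤ δ → G.dist x y ≤ B
  exists_ge : ∀ M, ∃ x, M ≤ g x
  exists_le : ∀ M, ∃ x, g x ≤ M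

theorem IsCoarseHeight.neg (h : IsCoarseHeight G o g δ B) :
    IsCoarseHeight G o (fun x => -g x) δ B where
  zero := by simp [h.zero]
  abs_sub_le x y hxy := by
    rw [neg_sub_neg]
    exact h.abs_sub_le y x hxy.symm
  dist_le x y hxy := by
    rw [neg_sub_neg] at hxy
    rw [SimpleGraph.dist_comm]
    exact h.dist_le y x hxy
  exists_ge M := (h.exists_le (-M)).imp fun x hx => le_neg_of_le_neg hx
  exists_le M := (h.exists_ge (-M)).imp fun x hx => neg_le_of_neg_le hx

/-- A discrete intermediate value theorem: one step changes the height by at most `δ`, so a path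
cannot jump over a window of that width. -/
theorem IsCoarseHeight.exists_mem_support (h : IsCoarseHeight G o g δ B) {x y : V}
    (p : G.Walk x y) {t : ℝ} (hx : g x ≤ t + δ) (hy : t ≤ g y) :
    ∃ z ∈ p.support, t ≤ g z ∧ g z ≤ t + δ := by
  induction p with
  | nil => exact ⟨_, by simp, hy, hx⟩
  | @cons x z y hxz p ih =>
    by_cases hxt : t ≤ g x
    · exact ⟨x, by simp, hxt, hx⟩
    · have := (abs_le.1 (h.abs_sub_le x z hxz)).1
      obtain ⟨w, hw, hw'⟩ := ih (by linarith) hy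
      exact ⟨w, by simp [hw], hw'⟩

/-- A geodesic from `o` to the higher vertex `y` passes a vertex `z` of nearly the height of `x`, so
`z` is within `B` of `x`. As `x` and `y` are equally far from `o`, the rest of the geodesic from `z`
to `y` also has length at most `B`. -/
theorem IsCoarseHeight.dist_le_of_dist_eq (h : IsCoarseHeight G o g δ B) (hδ : 0 ≤ δ)
    (hG : G.Connected) {x y : V} (hxy : G.dist o x = G.dist o y) (hx : 0 ≤ g x) (hy : 0 ≤ g y) :
    G.dist x y ≤ 2 * B := by
  classical
  wlog hle : g x ≤ g y generalizing x y
  · rw [SimpleGraph.dist_comm]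
    exact this hxy.symm hy hx (le_of_not_ge hle)
  obtain ⟨p, hp⟩ := hG.exists_walk_length_eq_dist o y
  obtain ⟨z, hz, hz1, hz2⟩ := h.exists_mem_support p (t := g x) (by rw [h.zero]; linarith) hle
  have hzx : G.dist z x ≤ B := h.dist_le z x (abs_le.2 ⟨by linarith, by linarith⟩)
  have h1 := SimpleGraph.dist_le (p.takeUntil z hz)
  have h2 := SimpleGraph.dist_le (p.dropUntil z hz)
  have h3 := congrArg SimpleGraph.Walk.length (p.take_spec hz)
  rw [SimpleGraph.Walk.length_append] at h3
  have h4 := hG.dist_triangle (u := o) (v := z) (w := x)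
  have h5 := hG.dist_triangle (u := x) (v := z) (w := y)
  rw [SimpleGraph.dist_comm (u := x) (v := z)] at h5
  omega

/-- Away from the base point the height does not change sign along paths. -/
theorem IsCoarseHeight.pos_of_walk (h : IsCoarseHeight G o g δ B) (hδ : 0 ≤ δ) {x y : V}
    (p : G.Walk x y) (hp : ∀ z ∈ p.support, B < G.dist o z) (hx : 0 < g x) : 0 < g y := by
  by_contra hy
  obtain ⟨z, hz, hz1, hz2⟩ := h.exists_mem_support p.reverse (t := 0) (by linarith) hx.le
  rw [SimpleGraph.Walk.support_reverse, List.mem_reverse] at hz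
  refine (hp z hz).not_ge (h.dist_le o z ?_)
  rw [h.zero, abs_le]
  constructor <;> linarith

theorem IsCoarseHeight.ne_zero (h : IsCoarseHeight G o g δ B) (hδ : 0 ≤ δ) {x : V}
    (hx : B < G.dist o x) : g x ≠ 0 := fun h0 =>
  hx.not_ge (h.dist_le o x (by simpa [h0, h.zero] using hδ))

theorem IsCoarseHeight.le_mul_dist (h : IsCoarseHeight G o g δ B) (hG : G.Connected) (x : V) :
    g x ≤ δ * G.dist o x := by
  have key : ∀ {x y : V} (p : G.Walk x y), g y ≤ g x + δ * p.length := by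
    intro x y p
    induction p with
    | nil => simp
    | @cons x z y hxz p ih =>
      have := (abs_le.1 (h.abs_sub_le x z hxz)).1
      rw [SimpleGraph.Walk.length_cons]
      push_cast
      linarith
  obtain ⟨p, hp⟩ := hG.exists_walk_length_eq_dist o x
  have := key p
  rwa [h.zero, zero_add, hp] at this

theorem QuasiIsometric.exists_isCoarseHeight (o : V)
    (h : QuasiIsometric (graphDist G) (fun m n : ℤ => dist m n)) :
    ∃ g δ B, 0 ≤ δ ∧ IsCoarseHeight G o g δ B := by
  obtain ⟨f, K, hK, hf, hsurj⟩ := h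
  beta_reduce at hf hsurj
  have hd : ∀ x y, |((f x : ℝ) - f o) - (f y - f o)| = dist (f x) (f y) := fun x y => by
    rw [Int.dist_eq]
    congr 1
    ring
  -- Adjacent vertices have images within `K * 1 + K`. Images within `2 * K` give `dist / K - K ≤ 2
  -- * K`, that is, distance at most `3 * K ^ 2`.
  refine ⟨fun x => f x - f o, 2 * K, ⌈3 * K ^ 2⌉₊, by positivity, by simp, ?_, ?_, ?_, ?_⟩
  · intro x y hxy
    rw [hd]
    have := (hf x y).2
    rw [graphDist, SimpleGraph.dist_eq_one_iff_adj.2 hxy] at this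
    push_cast at this
    linarith
  · intro x y hxy
    rw [hd] at hxy
    have h1 : 1 / K * graphDist G x y ≤ 3 * K := by linarith [(hf x y).1]
    have h2 : graphDist G x y ≤ 3 * K ^ 2 := by
      rw [one_div, inv_mul_le_iff₀ hK] at h1
      linarith
    have h3 : (G.dist x y : ℝ) ≤ ⌈3 * K ^ 2⌉₊ := h2.trans (Nat.le_ceil _)
    exact_mod_cast h3
  · intro M
    obtain ⟨x, hx⟩ := hsurj (f o + ⌈M + K⌉)
    refine ⟨x, ?_⟩
    rw [Int.dist_eq, abs_lt] at hx
    push_cast at hx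
    linarith [Int.le_ceil (M + K), hx.2]
  · intro M
    obtain ⟨x, hx⟩ := hsurj (f o + ⌊M - K⌋)
    refine ⟨x, ?_⟩
    rw [Int.dist_eq, abs_lt] at hx
    push_cast at hx
    linarith [Int.floor_le (M - K), hx.1]

end CoarseHeight

/-- A coarsely dense, coarsely isometric line in a metric space. -/
theorem quasiIsometric_int_of_line {V : Type u} {G : SimpleGraph V} (hG : G.Connected)
    (ι : ℤ → V) (E F : ℕ) (hι : ∀ v, ∃ k, G.dist v (ι k) ≤ E)
    (h1 : ∀ j k : ℤ, (G.dist (ι j) (ι k) : ℤ) ≤ |j - k| + F)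
    (h2 : ∀ j k : ℤ, |j - k| ≤ (G.dist (ι j) (ι k) : ℤ) + F) :
    QuasiIsometric (graphDist G) (fun m n : ℤ => dist m n) := by
  choose f hf using hι
  have key : ∀ u v, |(G.dist u v : ℤ) - (|f u - f v| : ℤ)| ≤ 2 * E + F := by
    intro u v
    have a1 := hf u
    have a2 := hf v
    have a3 := h1 (f u) (f v)
    have a4 := h2 (f u) (f v)
    have b1 := hG.dist_triangle (u := u) (v := ι (f u)) (w := v)
    have b2 := hG.dist_triangle (u := ι (f u)) (v := ι (f v)) (w := v)
    have b3 := hG.dist_triangle (u := ι (f u)) (v := u) (w := ι (f v))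
    have b4 := hG.dist_triangle (u := u) (v := v) (w := ι (f v))
    rw [SimpleGraph.dist_comm (u := ι (f v)) (v := v)] at b2
    rw [SimpleGraph.dist_comm (u := ι (f u)) (v := u)] at b3
    simp only [abs_eq_max_neg] at a3 a4 ⊢
    omega
  have keyR : ∀ u v, |graphDist G u v - dist (f u) (f v)| ≤ 2 * E + F := by
    intro u v
    have := key u v
    rw [Int.dist_eq, graphDist]
    exact_mod_cast this
  refine ⟨f, 2 * E + F + 1, by positivity, fun u v => ?_, fun z => ⟨ι z, ?_⟩⟩
  · have hk := abs_le.1 (keyR u v)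
    have h0 : 0 ≤ graphDist G u v := Nat.cast_nonneg _
    have hK : (1 : ℝ) ≤ 2 * E + F + 1 := by
      have : (0 : ℝ) ≤ 2 * E + F := by positivity
      linarith
    constructor
    · have : 1 / (2 * (E : ℝ) + F + 1) * graphDist G u v ≤ graphDist G u v :=
        mul_le_of_le_one_left h0 ((div_le_one (by linarith)).2 hK)
      linarith [hk.2]
    · have := mul_le_mul_of_nonneg_right hK h0
      linarith [hk.1]
  · have a1 := hf (ι z)
    have a2 := h2 z (f (ι z))
    have : |z - f (ι z)| < 2 * E + F + 1 := (by
      simp only [abs_eq_max_neg] at a2 ⊢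
      omega)
    beta_reduce
    rw [Int.dist_eq]
    exact_mod_cast this

namespace RComplex

variable {d : ℕ} {R : SubdivisionRule.{u} d} {K : RComplex.{u, v} R} {n m : ℕ}

/-! ### History graphs that are quasi-isometric to the line -/

section Height

variable {g : K.HistoryVertex → ℝ} {δ : ℝ} {B : ℕ}

theorem pos_of_walk (hK : K.IsFinite) (h : IsCoarseHeight K.historyGraph none g δ B) (hδ : 0 ≤ δ)
    {x y : K.HistoryVertex} (p : K.historyGraph.Walk x y) (hp : ∀ z ∈ p.support, B < level z)
    (hx : 0 < g x) : 0 < g y :=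
  h.pos_of_walk hδ p (fun z hz => (dist_origin hK z).symm ▸ hp z hz) hx

theorem pos_of_reachable (hK : K.IsFinite) (h : IsCoarseHeight K.historyGraph none g δ B)
    (hδ : 0 ≤ δ) (hn : B ≤ n) {a b : K.LevelVertex n} (hab : (K.levelGraph n).Reachable a b)
    (ha : 0 < g (some ⟨n, a⟩)) : 0 < g (some ⟨n, b⟩) := by
  obtain ⟨p⟩ := hab
  obtain ⟨q, -, hq⟩ := exists_horizontal_walk p
  exact pos_of_walk hK h hδ q (fun z hz => by rw [hq z hz]; omega) ha

theorem pos_iff_of_subset (hK : K.IsFinite) (h : IsCoarseHeight K.historyGraph none g δ B)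
    (hδ : 0 ≤ δ) (hn : B ≤ n) (hnm : n ≤ m) {a : K.LevelVertex n} {b : K.LevelVertex m}
    (hab : b.1 ⊆ a.1) : 0 < g (some ⟨n, a⟩) ↔ 0 < g (some ⟨m, b⟩) := by
  obtain ⟨p, -, hp⟩ := exists_vertical_walk hK hnm hab
  refine ⟨pos_of_walk hK h hδ p fun z hz => hn.trans_lt (hp z hz),
    pos_of_walk hK h hδ p.reverse fun z hz => hn.trans_lt (hp z ?_)⟩
  rwa [SimpleGraph.Walk.support_reverse, List.mem_reverse] at hz

theorem pos_or_neg (hK : K.IsFinite) (h : IsCoarseHeight K.historyGraph none g δ B)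
    (hδ : 0 ≤ δ) (hn : B ≤ n) (a : K.LevelVertex n) :
    0 < g (some ⟨n, a⟩) ∨ 0 < -g (some ⟨n, a⟩) := by
  have : g (some ⟨n, a⟩) ≠ 0 := h.ne_zero hδ (by rw [dist_origin hK]; exact Nat.lt_succ_of_le hn)
  rcases this.lt_or_gt with h | h
  · exact Or.inr (neg_pos.2 h)
  · exact Or.inl h

/-- The limit set contains points of positive height. -/
theorem exists_mem_limitSet_pos (hK : K.IsFinite) (h : IsCoarseHeight K.historyGraph none g δ B)
    (hδ : 0 ≤ δ) :
    ∃ p ∈ K.limitSet, ∀ a : K.LevelVertex B, p ∈ a.1 → 0 < g (some ⟨B, a⟩) := by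
  have : CompactSpace K.X := compactSpace_of_finite_cells hK
  -- Sign is inherited between ancestors and descendants beyond level `B`, so the closed cells of
  -- positive height form a decreasing sequence of compact sets.
  set T : ℕ → Set K.X := fun m =>
    ⋃ a ∈ {a : K.LevelVertex (B + m) | 0 < g (some ⟨B + m, a⟩)}, closure a.1 with hT
  have hTc : ∀ m, IsClosed (T m) := fun m => by
    have := finite_levelVertex hK (B + m)
    exact (toFinite _).isClosed_biUnion fun _ _ => isClosed_closure
  obtain ⟨p, hp⟩ : (⋂ m, T m).Nonempty := by
    refine IsCompact.nonempty_iInter_of_sequence_nonempty_isCompact_isClosed T ?_ ?_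
      (hTc 0).isCompact hTc
    · intro m x hx
      simp only [hT, mem_iUnion] at hx
      obtain ⟨a, ha, hx⟩ := hx
      obtain ⟨c, hc⟩ := exists_vertex_ancestor hK (Nat.le_succ (B + m)) a
      exact mem_biUnion (x := c) ((pos_iff_of_subset hK h hδ (Nat.le_add_right B m)
        (Nat.le_succ _) hc).2 ha) (closure_mono hc hx)
    · intro m
      -- Height is at most `δ` times the level, so a vertex this high lies deep enough to have an
      -- ancestor in `Γ_(B + m)`.
      obtain ⟨x, hx⟩ := h.exists_ge (δ * (B + m) + 1)
      have h1 := h.le_mul_dist (historyGraph_connected hK) x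
      rw [dist_origin hK] at h1
      have hlt : B + m < level x := by
        by_contra hcon
        have : (level x : ℝ) ≤ B + m := by exact_mod_cast not_lt.1 hcon
        linarith [mul_le_mul_of_nonneg_left this hδ]
      have hx0 : 0 < g x := by
        have : (0 : ℝ) ≤ δ * (B + m) := by positivity
        linarith
      obtain ⟨a, k, b, rfl, hk, hba⟩ := exists_below hK hlt
      obtain ⟨z, hz⟩ := vertex_nonempty a
      exact ⟨z, mem_biUnion (x := a) ((pos_iff_of_subset hK h hδ (Nat.le_add_right B m)
        hk hba).2 hx0) (subset_closure hz)⟩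
  rw [mem_iInter] at hp
  refine ⟨p, ?_, fun a ha => ?_⟩
  · rw [limitSet_eq_iInter hK, mem_iInter]
    intro m
    have := hp m
    simp only [hT, mem_iUnion] at this
    obtain ⟨a, -, hpa⟩ := this
    exact limitLevel_antitone hK (Nat.le_add_left m B) (closure_vertex_subset hK a hpa)
  · have := hp 0
    simp only [hT, mem_iUnion] at this
    obtain ⟨c, hc, hpc⟩ := this
    exact pos_of_reachable hK h hδ le_rfl (reachable_of_mem_closure hK ha hpc).symm hc

/-- The cells around two points of the limit set of positive height are at bounded distance in every
level graph. -/
theorem edist_le_of_pos (hK : K.IsFinite) (h : IsCoarseHeight K.historyGraph none g δ B)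
    (hδ : 0 ≤ δ) {p q : K.X} (hp : p ∈ K.limitSet) (hq : q ∈ K.limitSet)
    {a₀ b₀ : K.LevelVertex m} (hm : B ≤ m) (hpa : p ∈ a₀.1) (hqb : q ∈ b₀.1)
    (ha₀ : 0 < g (some ⟨m, a₀⟩)) (hb₀ : 0 < g (some ⟨m, b₀⟩)) {a b : K.LevelVertex n}
    (ha : p ∈ a.1) (hb : q ∈ b.1) : (K.levelGraph n).edist a b ≤ (2 * B : ℕ) := by
  -- At level `k` the two cells are within `2 * B` in the history graph. A geodesic between them is
  -- too short to climb past `Γ_n`, so it projects there.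
  set k := n + m + 2 * B with hk
  have hmk : m ≤ k := by omega
  have hnk : n ≤ k := by omega
  obtain ⟨a', ha'⟩ := exists_vertex hK (limitSet_subset hK k hp)
  obtain ⟨b', hb'⟩ := exists_vertex hK (limitSet_subset hK k hq)
  have h1 := (pos_iff_of_subset hK h hδ hm hmk (subset_of_mem hmk a'.2.1 a₀.2.1 ha' hpa)).1 ha₀
  have h2 := (pos_iff_of_subset hK h hδ hm hmk (subset_of_mem hmk b'.2.1 b₀.2.1 hb' hqb)).1 hb₀
  have h3 := h.dist_le_of_dist_eq hδ (historyGraph_connected hK)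
    (by rw [dist_origin hK, dist_origin hK]; rfl) h1.le h2.le
  obtain ⟨w, hw⟩ := (historyGraph_connected hK).exists_walk_length_eq_dist
    (some ⟨k, a'⟩ : K.HistoryVertex) (some ⟨k, b'⟩)
  refine (edist_le_of_walk hK w (fun z hz => ?_)
    ⟨k, a', rfl, hnk, subset_of_mem hnk a'.2.1 a.2.1 ha' ha⟩
    ⟨k, b', rfl, hnk, subset_of_mem hnk b'.2.1 b.2.1 hb' hb⟩).trans ?_
  · have := level_le_of_mem_support w hz
    simp only [level_some] at this
    omega
  · rw [hw]
    exact_mod_cast h3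

/-- Reachable cells of a deep level have the same sign. -/
theorem pos_or_neg_of_reachable (hK : K.IsFinite)
    (h : IsCoarseHeight K.historyGraph none g δ B) (hδ : 0 ≤ δ) (hn : B ≤ n)
    {a b : K.LevelVertex n} (hab : (K.levelGraph n).Reachable a b) :
    (0 < g (some ⟨n, a⟩) ∧ 0 < g (some ⟨n, b⟩)) ∨
      (0 < -g (some ⟨n, a⟩) ∧ 0 < -g (some ⟨n, b⟩)) :=
  (pos_or_neg hK h hδ hn a).imp (fun ha => ⟨ha, pos_of_reachable hK h hδ hn hab ha⟩)
    fun ha => ⟨ha, pos_of_reachable hK h.neg hδ hn hab ha⟩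

theorem card_components_eq_two (hK : K.IsFinite) (h : IsCoarseHeight K.historyGraph none g δ B)
    (hδ : 0 ≤ δ) : Nat.card (ConnectedComponents K.limitSet) = 2 := by
  obtain ⟨p, hp, hp'⟩ := exists_mem_limitSet_pos hK h hδ
  obtain ⟨q, hq, hq'⟩ := exists_mem_limitSet_pos hK h.neg hδ
  obtain ⟨a, ha⟩ := exists_vertex hK (limitSet_subset hK B hp)
  obtain ⟨b, hb⟩ := exists_vertex hK (limitSet_subset hK B hq)
  have hpa := hp' a ha
  have hqb := hq' b hb
  rw [Nat.card_eq_two_iff]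
  refine ⟨((⟨p, hp⟩ : K.limitSet) : ConnectedComponents K.limitSet),
    ((⟨q, hq⟩ : K.limitSet) : ConnectedComponents K.limitSet), fun heq => ?_,
    eq_univ_of_forall fun c => ?_⟩
  · have := pos_of_reachable hK h hδ le_rfl
      ((connectedComponents_eq_iff hK _ _).1 heq B a b ha hb) hpa
    linarith
  -- A point of `Λ` lies in the component of `p` or `q` according to the sign of its cell in `Γ_B`.
  · obtain ⟨r, rfl⟩ := ConnectedComponents.surjective_coe c
    obtain ⟨c, hc⟩ := exists_vertex hK (limitSet_subset hK B r.2)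
    rcases pos_or_neg hK h hδ le_rfl c with hpos | hneg
    · refine Or.inl ((connectedComponents_eq_iff hK _ _).2 fun n a' b' ha' hb' => ?_)
      exact SimpleGraph.reachable_of_edist_ne_top (ne_top_of_le_ne_top (ENat.natCast_ne_top _)
        (edist_le_of_pos hK h hδ r.2 hp le_rfl hc ha hpos hpa ha' hb'))
    · refine Or.inr ((connectedComponents_eq_iff hK _ _).2 fun n a' b' ha' hb' => ?_)
      exact SimpleGraph.reachable_of_edist_ne_top (ne_top_of_le_ne_top (ENat.natCast_ne_top _)
        (edist_le_of_pos hK h.neg hδ r.2 hq le_rfl hc hb hneg hqb ha' hb'))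

theorem history_edist_le (hK : K.IsFinite) (h : IsCoarseHeight K.historyGraph none g δ B)
    (hδ : 0 ≤ δ) {a b : K.LevelVertex n} (hab : (K.levelGraph n).Reachable a b) :
    K.historyGraph.edist (some ⟨n, a⟩) (some ⟨n, b⟩) ≤ (2 * B + 2 : ℕ) := by
  have hconn := historyGraph_connected hK
  rw [← (hconn _ _).coe_dist_eq_edist, Nat.cast_le]
  rcases le_or_gt B n with hn | hn
  · have hd : K.historyGraph.dist none (some ⟨n, a⟩) = K.historyGraph.dist none (some ⟨n, b⟩) := by
      rw [dist_origin hK, dist_origin hK]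
      rfl
    rcases pos_or_neg_of_reachable hK h hδ hn hab with ⟨h1, h2⟩ | ⟨h1, h2⟩
    · exact (h.dist_le_of_dist_eq hδ hconn hd h1.le h2.le).trans (Nat.le_add_right _ _)
    · exact (h.neg.dist_le_of_dist_eq hδ hconn hd h1.le h2.le).trans (Nat.le_add_right _ _)
  -- Near the origin, where signs are not controlled, the path through `O` of length `2 * n + 2` is
  -- short enough.
  · have := dist_le_level_add_level hK (some ⟨n, a⟩) (some ⟨n, b⟩)
    simp only [level_some] at this
    omega

theorem exists_level_edist_le (hK : K.IsFinite) (B : ℕ) : ∃ D : ℕ, ∀ n < B,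
    ∀ a b : K.LevelVertex n, (K.levelGraph n).Reachable a b → (K.levelGraph n).edist a b ≤ D := by
  have : ∀ n, ∃ D : ℕ, ∀ a b : K.LevelVertex n, (K.levelGraph n).Reachable a b →
      (K.levelGraph n).edist a b ≤ D := by
    intro n
    have := finite_levelVertex hK n
    obtain ⟨D, hD⟩ := (finite_range fun x : K.LevelVertex n × K.LevelVertex n =>
      (K.levelGraph n).dist x.1 x.2).bddAbove
    refine ⟨D, fun a b hab => ?_⟩
    rw [← hab.coe_dist_eq_edist, Nat.cast_le]
    exact hD ⟨(a, b), rfl⟩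
  choose D hD using this
  refine ⟨(Finset.range B).sup D, fun n hn a b hab => (hD n a b hab).trans ?_⟩
  exact_mod_cast Finset.le_sup (f := D) (Finset.mem_range.2 hn)

theorem exists_level_edist_le_of_meets (hK : K.IsFinite)
    (h : IsCoarseHeight K.historyGraph none g δ B) (hδ : 0 ≤ δ) :
    ∃ D : ℕ, ∀ (n : ℕ) (a b : K.LevelVertex n), (K.levelGraph n).Reachable a b →
      (a.1 ∩ K.limitSet).Nonempty → (b.1 ∩ K.limitSet).Nonempty →
      (K.levelGraph n).edist a b ≤ D := by
  obtain ⟨D, hD⟩ := exists_level_edist_le hK B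
  refine ⟨max D (2 * B), fun n a b hab ⟨p, hpa, hp⟩ ⟨q, hqb, hq⟩ => ?_⟩
  rcases le_or_gt B n with hn | hn
  · refine le_trans ?_ (Nat.cast_le.2 (le_max_right D (2 * B)))
    rcases pos_or_neg_of_reachable hK h hδ hn hab with ⟨h1, h2⟩ | ⟨h1, h2⟩
    · exact edist_le_of_pos hK h hδ hp hq hn hpa hqb h1 h2 hpa hqb
    · exact edist_le_of_pos hK h.neg hδ hp hq hn hpa hqb h1 h2 hpa hqb
  · exact (hD n hn a b hab).trans (Nat.cast_le.2 (le_max_left _ _))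

end Height

/-- If the limit set has two components and reachable cells of `Γ_n` which meet the limit set are at
bounded distance in the history graph, then the history graph is quasi-isometric to the line. -/
theorem quasiIsometric_int (hK : K.IsFinite)
    (hcard : Nat.card (ConnectedComponents K.limitSet) = 2) (D : ℕ)
    (hD : ∀ (n : ℕ) (a b : K.LevelVertex n), (K.levelGraph n).Reachable a b →
      (a.1 ∩ K.limitSet).Nonempty → (b.1 ∩ K.limitSet).Nonempty →
      K.historyGraph.edist (some ⟨n, a⟩) (some ⟨n, b⟩) ≤ D) :
    QuasiIsometric (graphDist K.historyGraph) (fun m n : ℤ => dist m n) := by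
  classical
  have hconn := historyGraph_connected hK
  obtain ⟨c₁, c₂, hne, hun⟩ := Nat.card_eq_two_iff.1 hcard
  obtain ⟨p, rfl⟩ := ConnectedComponents.surjective_coe c₁
  obtain ⟨q, rfl⟩ := ConnectedComponents.surjective_coe c₂
  choose x hx using fun n => exists_vertex hK (limitSet_subset hK n p.2)
  choose y hy using fun n => exists_vertex hK (limitSet_subset hK n q.2)
  obtain ⟨n₀, a₀, b₀, ha₀, hb₀, hnr⟩ : ∃ (n : ℕ) (a b : K.LevelVertex n),
      p.1 ∈ a.1 ∧ q.1 ∈ b.1 ∧ ¬ (K.levelGraph n).Reachable a b := by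
    by_contra! hcon
    exact hne ((connectedComponents_eq_iff hK p q).2 hcon)
  obtain ⟨N, hN⟩ := exists_near_limitSet hK
  -- The line descends along the ray of `p` on `k ≥ 0` and along the ray of `q` on `k < 0`; the
  -- vertex `y n` sits at `-n - 1`.
  let ι : ℤ → K.HistoryVertex := fun k =>
    match k with
    | Int.ofNat n => some ⟨n, x n⟩
    | Int.negSucc n => some ⟨n, y n⟩
  have hray : ∀ {p : K.X} {x : ∀ n, K.LevelVertex n}, (∀ n, p ∈ (x n).1) → ∀ {i j}, i ≤ j →
      K.historyGraph.dist (some ⟨i, x i⟩) (some ⟨j, x j⟩) ≤ j - i := by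
    intro p x hx i j hij
    obtain ⟨w, hw, -⟩ := exists_vertical_walk hK hij
      (subset_of_mem hij (x j).2.1 (x i).2.1 (hx j) (hx i))
    exact hw ▸ SimpleGraph.dist_le w
  have hlev : ∀ u v : K.HistoryVertex, level v ≤ level u + K.historyGraph.dist u v := by
    intro u v
    obtain ⟨w, hw⟩ := hconn.exists_walk_length_eq_dist u v
    exact hw ▸ level_le_of_walk w
  have hup : ∀ i j, K.historyGraph.dist (some ⟨i, x i⟩) (some ⟨j, y j⟩) ≤ i + j + 2 := by
    intro i j
    have := dist_le_level_add_level hK (some ⟨i, x i⟩) (some ⟨j, y j⟩)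
    simp only [level_some] at this
    omega
  have hlow : ∀ i j, i + j ≤ K.historyGraph.dist (some ⟨i, x i⟩) (some ⟨j, y j⟩) + 2 * n₀ := by
    intro i j
    have h1 := hlev (some ⟨i, x i⟩) (some ⟨j, y j⟩)
    have h2 := hlev (some ⟨j, y j⟩) (some ⟨i, x i⟩)
    rw [SimpleGraph.dist_comm] at h2
    simp only [level_some] at h1 h2
    by_cases hi : i < n₀
    · omega
    by_cases hj : j < n₀
    · omega
    have hi := not_lt.1 hi
    have hj := not_lt.1 hj
    obtain ⟨w, hw⟩ := hconn.exists_walk_length_eq_dist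
      (some ⟨i, x i⟩ : K.HistoryVertex) (some ⟨j, y j⟩)
    -- A path staying deeper would project to one joining `a₀` to `b₀` in `Γ_n₀`.
    obtain ⟨z, hz, hzl⟩ : ∃ z ∈ w.support, level z ≤ n₀ := by
      by_contra! hcon
      refine hnr (SimpleGraph.reachable_of_edist_ne_top (ne_top_of_le_ne_top
        (ENat.natCast_ne_top w.length) (edist_le_of_walk hK w hcon
          ⟨i, x i, rfl, hi, subset_of_mem hi (x i).2.1 a₀.2.1 (hx i) ha₀⟩
          ⟨j, y j, rfl, hj, subset_of_mem hj (y j).2.1 b₀.2.1 (hy j) hb₀⟩)))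
    have h3 := level_le_of_walk (w.takeUntil z hz).reverse
    have h4 := level_le_of_walk (w.dropUntil z hz)
    have h5 := congrArg SimpleGraph.Walk.length (w.take_spec hz)
    rw [SimpleGraph.Walk.length_append] at h5
    rw [SimpleGraph.Walk.length_reverse] at h3
    simp only [level_some] at h3 h4
    omega
  have hsame : ∀ {p : K.X} {x : ∀ n, K.LevelVertex n}, (∀ n, p ∈ (x n).1) → ∀ i j : ℕ,
      (K.historyGraph.dist (some ⟨i, x i⟩) (some ⟨j, x j⟩) : ℤ) = |(i : ℤ) - j| := by
    intro p x hx i j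
    have h1 := hlev (some ⟨i, x i⟩) (some ⟨j, x j⟩)
    have h2 := hlev (some ⟨j, x j⟩) (some ⟨i, x i⟩)
    rw [SimpleGraph.dist_comm] at h2
    simp only [level_some] at h1 h2
    rcases le_total i j with hij | hij
    · have := hray hx hij
      simp only [abs_eq_max_neg]
      omega
    · have := hray hx hij
      rw [SimpleGraph.dist_comm] at this
      simp only [abs_eq_max_neg]
      omega
  -- A deep vertex reaches the line by `N` steps up, two steps to a cell meeting `Λ`, and at most
  -- `D` more to a ray; a vertex of level at most `N` goes through `O`. The `1` in the additive
  -- error comes from the index shift of the negative ray.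
  refine quasiIsometric_int_of_line hconn ι (N + 3 + D) (2 * n₀ + 1) ?_ ?_ ?_
  · intro v
    have hclose : ∀ n (c : K.LevelVertex n), (c.1 ∩ K.limitSet).Nonempty →
        ∃ k, K.historyGraph.dist (some ⟨n, c⟩) (ι k) ≤ D := by
      rintro n c ⟨r, hrc, hr⟩
      have hr' : ((⟨r, hr⟩ : K.limitSet) : ConnectedComponents K.limitSet) ∈
          ({(p : ConnectedComponents K.limitSet), (q : ConnectedComponents K.limitSet)} : Set _) :=
        hun ▸ mem_univ _
      rcases hr' with h | h
      · refine ⟨Int.ofNat n, ?_⟩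
        have := hD n c (x n) ((connectedComponents_eq_iff hK _ _).1 h n c (x n) hrc (hx n))
          ⟨r, hrc, hr⟩ ⟨p, hx n, p.2⟩
        rwa [← (hconn _ _).coe_dist_eq_edist, Nat.cast_le] at this
      · refine ⟨Int.negSucc n, ?_⟩
        have := hD n c (y n) ((connectedComponents_eq_iff hK _ _).1 h n c (y n) hrc (hy n))
          ⟨r, hrc, hr⟩ ⟨q, hy n, q.2⟩
        rwa [← (hconn _ _).coe_dist_eq_edist, Nat.cast_le] at this
    rcases le_or_gt (level v) N with hv | hv
    · refine ⟨Int.ofNat 0, ?_⟩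
      have := dist_le_level_add_level hK v (some ⟨0, x 0⟩)
      simp only [level_some] at this
      exact this.trans (by omega)
    · rcases v with _ | ⟨k, b⟩
      · exact (Nat.not_lt_zero _ hv).elim
      obtain ⟨n, rfl⟩ := Nat.exists_eq_add_of_le' (Nat.lt_succ_iff.1 hv)
      obtain ⟨a, t, c, hba, hat, hct, hc⟩ := hN n b
      obtain ⟨k, hk⟩ := hclose n c hc
      refine ⟨k, ?_⟩
      obtain ⟨w, hw, -⟩ := exists_vertical_walk hK (Nat.le_add_right n N) hba
      have h1 := SimpleGraph.dist_le w.reverse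
      have hadj : ∀ {a t : K.LevelVertex n}, (a = t ∨ (K.levelGraph n).Adj a t) →
          K.historyGraph.dist (some ⟨n, a⟩) (some ⟨n, t⟩) ≤ 1 := by
        rintro a t (rfl | h)
        · simp
        · obtain ⟨w, hw, -⟩ := exists_horizontal_walk h.toWalk
          exact (SimpleGraph.dist_le w).trans (by simp [hw])
      have h2 := hadj hat
      have h3 := hadj (hct.imp Eq.symm SimpleGraph.Adj.symm)
      have t1 := hconn.dist_triangle (u := some ⟨n + N, b⟩) (v := some ⟨n, a⟩) (w := ι k)
      have t2 := hconn.dist_triangle (u := some ⟨n, a⟩) (v := some ⟨n, t⟩) (w := ι k)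
      have t3 := hconn.dist_triangle (u := some ⟨n, t⟩) (v := some ⟨n, c⟩) (w := ι k)
      rw [SimpleGraph.Walk.length_reverse] at h1
      omega
  · rintro (i | i) (j | j)
    · have := hsame hx i j
      simp only [ι, Int.ofNat_eq_natCast]
      simp only [abs_eq_max_neg] at this ⊢
      omega
    · have := hup i j
      simp only [ι, Int.ofNat_eq_natCast]
      simp only [Int.negSucc_eq, abs_eq_max_neg] at this ⊢
      omega
    · have := hup j i
      rw [SimpleGraph.dist_comm] at this
      simp only [ι, Int.ofNat_eq_natCast]
      simp only [Int.negSucc_eq, abs_eq_max_neg] at this ⊢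
      omega
    · have := hsame hy i j
      simp only [ι]
      simp only [Int.negSucc_eq, abs_eq_max_neg] at this ⊢
      omega
  · rintro (i | i) (j | j)
    · have := hsame hx i j
      simp only [ι, Int.ofNat_eq_natCast]
      simp only [abs_eq_max_neg] at this ⊢
      omega
    · have := hlow i j
      simp only [ι, Int.ofNat_eq_natCast]
      simp only [Int.negSucc_eq, abs_eq_max_neg] at this ⊢
      omega
    · have := hlow j i
      rw [SimpleGraph.dist_comm] at this
      simp only [ι, Int.ofNat_eq_natCast]
      simp only [Int.negSucc_eq, abs_eq_max_neg] at this ⊢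
      omega
    · have := hsame hy i j
      simp only [ι]
      simp only [Int.negSucc_eq, abs_eq_max_neg] at this ⊢
      omega

end RComplex

theorem mainTheorem9 {d : ℕ} (R : SubdivisionRule.{u} d) (K : RComplex.{u, v} R)
    (hK : K.IsFinite)
    {G : Type w} [Group G] (A : Set G) (hA : A.Finite) (hA' : Subgroup.closure A = ⊤)
    (hG : QuasiIsometric (graphDist K.historyGraph) (graphDist (SimpleGraph.mulCayley A))) :
    (QuasiIsometric (graphDist K.historyGraph) (fun m n : ℤ => dist m n) ↔
      Nat.card (ConnectedComponents K.limitSet) = 2 ∧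
      ∃ D : ℕ, ∀ (n : ℕ) (a b : K.LevelVertex n), K.SameComponent n a b →
        K.historyGraph.edist (some ⟨n, a⟩) (some ⟨n, b⟩) ≤ D) ∧
    (QuasiIsometric (graphDist K.historyGraph) (fun m n : ℤ => dist m n) ↔
      Nat.card (ConnectedComponents K.limitSet) = 2 ∧
      ∃ D : ℕ, ∀ (n : ℕ) (a b : K.LevelVertex n), K.SameComponent n a b →
        (a.1 ∩ K.limitSet).Nonempty → (b.1 ∩ K.limitSet).Nonempty →
        (K.levelGraph n).edist a b ≤ D) := by
  have hconn := RComplex.historyGraph_connected hK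
  simp only [RComplex.sameComponent_iff_reachable hK]
  refine ⟨⟨fun h => ?_, fun ⟨hcard, D, hD⟩ => ?_⟩, ⟨fun h => ?_, fun ⟨hcard, D, hD⟩ => ?_⟩⟩
  · obtain ⟨g, δ, B, hδ, hg⟩ := h.exists_isCoarseHeight none
    exact ⟨RComplex.card_components_eq_two hK hg hδ, _, fun n a b hab =>
      RComplex.history_edist_le hK hg hδ hab⟩
  · exact RComplex.quasiIsometric_int hK hcard D fun n a b hab _ _ => hD n a b hab
  · obtain ⟨g, δ, B, hδ, hg⟩ := h.exists_isCoarseHeight none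
    exact ⟨RComplex.card_components_eq_two hK hg hδ,
      RComplex.exists_level_edist_le_of_meets hK hg hδ⟩
  · refine RComplex.quasiIsometric_int hK hcard D fun n a b hab ha hb => ?_
    -- Distances in the history graph are at most those in `Γ_n`, since `Γ_n` embeds in it.
    obtain ⟨w, hw⟩ := hab.exists_walk_length_eq_edist
    obtain ⟨q, hq, -⟩ := RComplex.exists_horizontal_walk w
    refine (SimpleGraph.edist_le q).trans ?_
    rw [hq, hw]
    exact hD n a b hab ha hb
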